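/- **Setting.** Let $G=(V,E)$ be a finite undirected graph (parallel edges allowed) with edge costs $c_e\ge 0$ and source-sink pairs $(s_1,t_1),\dots,(s_r,t_r)$, $s_i\neq t_i$. In 2-route multicut one seeks a cheap set $Z\subseteq E$ such that for every $i$ the graph $(V,E\setminus Z)$ does not contain two edge-disjoint $s_i$-$t_i$ paths; such a $Z$ is called feasible. Let $(x,\{y^i\}_{i=1}^r)$ be an optimal solution, of value $\mathrm{OPT}=\sum_e c_ex_e$, of the linear program $$\min \sum_e c_e x_e\quad\text{s.t.}\quad \sum_{e\in P}(x_e+y^i_e)\ge 1\ \ \text{for all } i \text{ and all simple } s_i\text{-}t_i \text{ paths } P;\quad \sum_e y^i_e\le 1\ \ \text{for all } i;\quad x,y\ge 0. \tag{P}$$ **Subdivision.** Replace every edge $e$ by a path of $r+1$ edges $e_0,\dots,e_r$, each of cost $c_e$; put $x_{e_0}=x_e$, $y^i_{e_i}=y^i_e$ and all other values $0$. From here on $G=(V,E)$, $x$, $y^i$ denote the subdivided graph and these values; the edges $e_0$ are called $x$-edges. A set $Z$ of edges of the subdivided graph corresponds to the set $\bar Z$ of all original edges $e$ with some $e_j\in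 Z$. **Notation.** Let $\ell^i$ be the shortest-path metric of $G$ for the lengths $x_e+y^i_e$ (with value $\infty$ between different components), and $\beta=\mathrm{OPT}/r$. For $S\subseteq V$ let $E(S)$ be the set of edges with both ends in $S$, $\delta^S(A)$ the set of edges between $A$ and $S\setminus A$ (for $A\subseteq S$), and $\mathcal V^x(S)=\beta+\sum_{e\in E(S)}c_ex_e$. Let $c^2(D)$ be the cost of all edges of $D$ except the most expensive one. For a commodity $i$ and $\rho\ge 0$ let $B=\{v\in S:\ell^i(s_i,v)\le\rho\}$, $\bar B=S\setminus B$, and $$\mathcal V=\beta+\sum_{uv}c_{uv}\ell^i(u,v)+\sum_{uv}c_{uv}(\rho-\ell^i(s_i,u)),\qquad \overline{\mathcal V}=\beta+\sum_{uv}c_{uv}\ell^i(u,v)+\sum_{uv}c_{uv}(\ell^i(s_i,v)-\rho),$$ where all sums are over $x$-edges $uv$: the first sum of $\mathcal V$ over those with $u,v\in B$, the first sum of $\overline{\mathcal V}$ over those with $u,v\in\bar B$, and the second sums over those with $u\in B$, $v\in\bar B$. Call $\rho$ *good* for $(S,i)$ if $0\le\rho<1$ and $$c^2(\delta^S(B))\le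 4\,W\,\ln\Bigl(\frac{e\,\mathcal V^x(S)}{W}\Bigr)\,\ln\ln(e(r+1))\qquad\text{for } W=\mathcal V \text{ and for } W=\overline{\mathcal V}$$ (the right side being read as $0$ if $W=0$). **Algorithm 2-MCAlg$(U,\mathcal T)$**, for $U\subseteq V$ and a set $\mathcal T$ of source-sink pairs contained in $U$. Start with $S=U$, $Z=\emptyset$, $\mathcal S=\emptyset$. While some pair of $\mathcal T$ has two edge-disjoint paths in $(S,E(S))$: pick such a pair $(s_i,t_i)$ and a $\rho$ that is good for $(S,i)$; let $A=B$ if $B$ contains at most $|\mathcal T|/2$ pairs of $\mathcal T$, and $A=\bar B$ otherwise; add $A$ to $\mathcal S$, add all edges of $\delta^S(A)$ except a most expensive one to $Z$, and replace $S$ by $S\setminus A$. Afterwards, for every $A\in\mathcal S$ add to $Z$ the output of 2-MCAlg$(A,\{(s_i,t_i)\in\mathcal T: s_i,t_i\in A\})$; return $Z$. The initial call is 2-MCAlg$(V,\{(s_1,t_1),\dots,(s_r,t_r)\})$. **Theorem.** There is an absolute constant $C>0$ such that for every instance and every optimal solution of (P), whatever choices are made, the initial call of 2-MCAlg never gets stuck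 (a good radius always exists) and terminates, and for its output $Z$: 1. $Z$ is feasible for the subdivided instance and $\bar Z$ is feasible for the original one: every pair $s_i,t_i$ is at most 1-edge-connected in the graph that remains after the removal of the set; 2. $c(\bar Z)\le c(Z)\le C\,\ln(r+1)\,\ln\ln(e(r+1))\cdot\mathrm{OPT}$, and $c(Z)\le C\,\ln r\,\ln\ln r\cdot\mathrm{OPT}$ if $r\ge 3$; that is, the cost is $O(\ln r\ln\ln r)\cdot\mathrm{OPT}$. -/

import Mathlib

open scoped ENNReal

/-- An undirected multigraph with node set `V` and edge set `E`. Parallel edges are allowed. The two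
ends of an edge are listed in an arbitrary order, which carries no meaning: see `Joins`. -/
structure Multigraph (V : Type*) (E : Type*) where
  fst : E → V
  snd : E → V

namespace Multigraph

universe u v

variable {V : Type u} {E : Type v} (G : Multigraph V E)

/-- `e` is an (undirected) edge between `a` and `b`. -/
def Joins (e : E) (a b : V) : Prop :=
  (G.fst e = a ∧ G.snd e = b) ∨ (G.fst e = b ∧ G.snd e = a)

inductive Walk : V → V → Type (max u v)
  | nil (a : V) : Walk a a
  | cons {a b d : V} (e : E) (h : G.Joins e a b) (p : Walk b d) : Walk a d

namespace Walk

variable {G}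

def edges : {a b : V} → G.Walk a b → List E
  | _, _, nil _ => []
  | _, _, cons e _ p => e :: p.edges

def support : {a b : V} → G.Walk a b → List V
  | _, _, nil a => [a]
  | a, _, cons _ _ p => a :: p.support

/-- A simple path: no node is repeated. -/
def IsPath {a b : V} (p : G.Walk a b) : Prop := p.support.Nodup

/-- The length of a walk with respect to the edge lengths `w`. -/
def length (w : E → ℝ) {a b : V} (p : G.Walk a b) : ℝ := (p.edges.map w).sum

end Walk

/-- `E(S)`: the edges with both ends in `S`. -/
def edgesIn (S : Set V) : Set E := {e | G.fst e ∈ S ∧ G.snd e ∈ S}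

/-- `δ^S(A)`: the edges with one end in `A` and the other one in `S \ A`. -/
def cut (S A : Set V) : Set E :=
  {e | (G.fst e ∈ A ∧ G.snd e ∈ S \ A) ∨ (G.snd e ∈ A ∧ G.fst e ∈ S \ A)}

/-- `a` and `b` are at least `k`-edge-connected by means of the edges in `D`: there are `k` pairwise
edge-disjoint simple `a`-`b` paths all of whose edges belong to `D`. -/
def EdgeConnected (D : Set E) (k : ℕ) (a b : V) : Prop :=
  ∃ P : Fin k → G.Walk a b,
    (∀ j, (P j).IsPath) ∧ (∀ j, ∀ e ∈ (P j).edges, e ∈ D) ∧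
      ∀ j j', j ≠ j' → List.Disjoint (P j).edges (P j').edges

/-- The shortest-path distance for the edge lengths `w`; it is `∞` if there is no walk. -/
noncomputable def edist (w : E → ℝ) (a b : V) : ℝ≥0∞ :=
  ⨅ p : G.Walk a b, ENNReal.ofReal (p.length w)

/-- The same distance as a real number; it is only used for nodes at finite distance. -/
noncomputable def dist (w : E → ℝ) (a b : V) : ℝ := (G.edist w a b).toReal

/-- `B_ℓ(z, ρ)` for the shortest-path metric `ℓ` of the edge lengths `w`. -/
def ball (w : E → ℝ) (z : V) (ρ : ℝ) : Set V := {b | G.edist w z b ≤ ENNReal.ofReal ρ}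

end Multigraph

/-- A multicut instance with `r` source-sink pairs (commodities) and nonnegative edge costs. -/
structure MulticutInstance (V : Type*) (E : Type*) (r : ℕ) extends Multigraph V E where
  cost : E → ℝ
  cost_nonneg : ∀ e, 0 ≤ cost e
  source : Fin r → V
  sink : Fin r → V
  source_ne_sink : ∀ i, source i ≠ sink i

namespace MulticutInstance

section Problem

variable {V E : Type*} [Fintype E] {r : ℕ} (I : MulticutInstance V E r)

/-- `c(Z)`, the cost of an edge set. -/
noncomputable def costOf (Z : Set E) : ℝ := ∑ e, Z.indicator I.cost e

/-- `c²(D)`: the cost of all edges of `D` but the most expensive one; it is `0` for `D = ∅`, since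
`sSup ∅ = 0`. -/
noncomputable def costButMax (D : Set E) : ℝ := I.costOf D - sSup (I.cost '' D)

/-- `Y` consists of all edges of `D` but one most expensive edge of `D` (ties are broken
arbitrarily). -/
def IsAllButMax (D Y : Set E) : Prop :=
  (D = ∅ ∧ Y = ∅) ∨ ∃ e ∈ D, (∀ f ∈ D, I.cost f ≤ I.cost e) ∧ Y = D \ {e}

/-- `Z` is a feasible solution of `k`-route multicut: after the removal of `Z` no source-sink pair
has `k` edge-disjoint paths. -/
def IsFeasible (k : ℕ) (Z : Set E) : Prop :=
  ∀ i, ¬ I.EdgeConnected Zᶜ k (I.source i) (I.sink i)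

/-- Feasibility for the LP relaxation
`min ∑ c_e x_e` s.t. `∑_{e ∈ P} (x_e + y^i_e) ≥ 1` for all `i` and all simple `s_i`-`t_i` paths `P`,
`∑_e y^i_e ≤ k - 1` for all `i`, and `x, y ≥ 0`. -/
structure IsLPFeasible (k : ℕ) (x : E → ℝ) (y : Fin r → E → ℝ) : Prop where
  path : ∀ i, ∀ P : I.Walk (I.source i) (I.sink i), P.IsPath → 1 ≤ P.length (fun e => x e + y i e)
  budget : ∀ i, ∑ e, y i e ≤ (k : ℝ) - 1
  x_nonneg : ∀ e, 0 ≤ x e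
  y_nonneg : ∀ i e, 0 ≤ y i e

noncomputable def lpValue (x : E → ℝ) : ℝ := ∑ e, I.cost e * x e

def IsLPOptimal (k : ℕ) (x : E → ℝ) (y : Fin r → E → ℝ) : Prop :=
  I.IsLPFeasible k x y ∧ ∀ x' y', I.IsLPFeasible k x' y' → I.lpValue x ≤ I.lpValue x'

end Problem

section Subdivision

variable {V E : Type*} {r : ℕ} (I : MulticutInstance V E r)

/-- The nodes `w_0, w_1, …, w_r, w_{r+1}` of the path that replaces the edge `e`: `w_0` and `w_{r+1}`
are the ends of `e`, the others are new. -/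
def subNode (e : E) (j : Fin (r + 2)) : V ⊕ E × Fin r :=
  Fin.cases (Sum.inl (I.fst e))
    (fun j' : Fin (r + 1) =>
      Fin.lastCases (motive := fun _ => V ⊕ E × Fin r) (Sum.inl (I.snd e))
        (fun m : Fin r => Sum.inr (e, m)) j') j

/-- The instance in which every edge `e` is subdivided into `r + 1` edges `e_0, …, e_r`, each of the
cost of `e`; here `e_j` is the pair `(e, j)`. -/
def subdivide : MulticutInstance (V ⊕ E × Fin r) (E × Fin (r + 1)) r where
  fst f := I.subNode f.1 f.2.castSucc
  snd f := I.subNode f.1 f.2.succ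
  cost f := I.cost f.1
  cost_nonneg f := I.cost_nonneg f.1
  source i := Sum.inl (I.source i)
  sink i := Sum.inl (I.sink i)
  source_ne_sink i h := I.source_ne_sink i (Sum.inl_injective h)

/-- The `x`-edges `e_0` of the subdivided graph. -/
def xEdges (E : Type*) (r : ℕ) : Set (E × Fin (r + 1)) := {f | f.2 = 0}

/-- The whole `x`-value of `e` is put on `e_0`. -/
def subX (r : ℕ) (x : E → ℝ) (f : E × Fin (r + 1)) : ℝ := if f.2 = 0 then x f.1 else 0

/-- The whole `y^i`-value of `e` is put on `e_i` (commodities are numbered from `0` in `Fin r`, so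
that this is the subdivision edge with index `i.succ`). -/
def subY (y : Fin r → E → ℝ) (i : Fin r) (f : E × Fin (r + 1)) : ℝ :=
  if f.2 = i.succ then y i f.1 else 0

/-- The edge set of the original graph given by an edge set of the subdivided graph: the edges that
have a part in it. -/
def unsubdivide (Z : Set (E × Fin (r + 1))) : Set E := Prod.fst '' Z

end Subdivision

section Rounding

/-! The recursive rounding procedure, on an instance `I` with edge set `E`, with a set `F` of edges
that count for the volume (the `x`-edges) and a fractional solution `(x, y)`. -/

variable {V E : Type*} [Fintype E] {r : ℕ} (I : MulticutInstance V E r)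
  (F : Set E) (x : E → ℝ) (y : Fin r → E → ℝ)

/-- `β = OPT / r`. -/
noncomputable def beta : ℝ := I.lpValue x / r

/-- `ℓ^i`, the shortest-path metric of the lengths `x + y^i`. -/
noncomputable def ell (i : Fin r) (a b : V) : ℝ := I.dist (fun e => x e + y i e) a b

/-- `B^S_i(z, ρ)`. -/
def ballIn (S : Set V) (i : Fin r) (z : V) (ρ : ℝ) : Set V :=
  I.ball (fun e => x e + y i e) z ρ ∩ S

/-- The complement of `B^S_i(z, ρ)` in `S`. -/
def ballOut (S : Set V) (i : Fin r) (z : V) (ρ : ℝ) : Set V :=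
  S \ I.ball (fun e => x e + y i e) z ρ

/-- The volume of the ball `B^S_i(z, ρ)`. The last two sums run over the boundary edges; they
differ in which end lies in the ball. -/
noncomputable def vol (S : Set V) (i : Fin r) (z : V) (ρ : ℝ) : ℝ :=
  I.beta x
    + ∑ e, (F ∩ I.edgesIn (I.ballIn x y S i z ρ)).indicator
        (fun e => I.cost e * I.ell x y i (I.fst e) (I.snd e)) e
    + ∑ e, {e ∈ F | I.fst e ∈ I.ballIn x y S i z ρ ∧ I.snd e ∈ I.ballOut x y S i z ρ}.indicator
        (fun e => I.cost e * (ρ - I.ell x y i z (I.fst e))) e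
    + ∑ e, {e ∈ F | I.snd e ∈ I.ballIn x y S i z ρ ∧ I.fst e ∈ I.ballOut x y S i z ρ}.indicator
        (fun e => I.cost e * (ρ - I.ell x y i z (I.snd e))) e

/-- The volume of the complement of `B^S_i(z, ρ)` in `S`. -/
noncomputable def volOut (S : Set V) (i : Fin r) (z : V) (ρ : ℝ) : ℝ :=
  I.beta x
    + ∑ e, (F ∩ I.edgesIn (I.ballOut x y S i z ρ)).indicator
        (fun e => I.cost e * I.ell x y i (I.fst e) (I.snd e)) e
    + ∑ e, {e ∈ F | I.fst e ∈ I.ballIn x y S i z ρ ∧ I.snd e ∈ I.ballOut x y S i z ρ}.indicator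
        (fun e => I.cost e * (I.ell x y i z (I.snd e) - ρ)) e
    + ∑ e, {e ∈ F | I.snd e ∈ I.ballIn x y S i z ρ ∧ I.fst e ∈ I.ballOut x y S i z ρ}.indicator
        (fun e => I.cost e * (I.ell x y i z (I.fst e) - ρ)) e

/-- `V^x(S) = β + ∑_{e ∈ E(S)} c_e x_e`. -/
noncomputable def volX (S : Set V) : ℝ :=
  I.beta x + ∑ e, (I.edgesIn S).indicator (fun e => I.cost e * x e) e

/-- The radii that the algorithm may use for the commodity `i` and the current set `S` (the
constant is `2 / (1 - α)` for `α = 1 / 2`). If `OPT = 0`, then all volumes are `0`, and the right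
sides are read as `0`. -/
def GoodRadius (S : Set V) (i : Fin r) (ρ : ℝ) : Prop :=
  0 ≤ ρ ∧ ρ < 1 ∧
    I.costButMax (I.cut S (I.ballIn x y S i (I.source i) ρ)) ≤
      4 * I.vol F x y S i (I.source i) ρ *
        Real.log (Real.exp 1 * I.volX x S / I.vol F x y S i (I.source i) ρ) *
        Real.log (Real.log (Real.exp 1 * (r + 1))) ∧
    I.costButMax (I.cut S (I.ballIn x y S i (I.source i) ρ)) ≤
      4 * I.volOut F x y S i (I.source i) ρ *
        Real.log (Real.exp 1 * I.volX x S / I.volOut F x y S i (I.source i) ρ) *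
        Real.log (Real.log (Real.exp 1 * (r + 1)))

/-- The pairs of `T` that are contained in `A`; pairs are represented by their indices. -/
def pairsIn (T : Set (Fin r)) (A : Set V) : Set (Fin r) :=
  {i ∈ T | I.source i ∈ A ∧ I.sink i ∈ A}

/-- `T'`: the pairs of `T` that are at least 2-edge-connected in `(S, E(S))`. -/
def active (T : Set (Fin r)) (S : Set V) : Set (Fin r) :=
  {i ∈ T | I.EdgeConnected (I.edgesIn S) 2 (I.source i) (I.sink i)}

/-- The region that is carved out: the ball if it contains at most half of the pairs of `T`, and
its complement in `S` otherwise. -/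
noncomputable def region (T : Set (Fin r)) (S : Set V) (i : Fin r) (ρ : ℝ) : Set V :=
  if 2 * (I.pairsIn T (I.ballIn x y S i (I.source i) ρ)).ncard ≤ T.ncard then
    I.ballIn x y S i (I.source i) ρ
  else I.ballOut x y S i (I.source i) ρ

/-- One iteration of the while loop, with current set `S`, may carve out the region `A` and add the
edge set `Y` to the solution. -/
def Step (T : Set (Fin r)) (S A : Set V) (Y : Set E) : Prop :=
  ∃ i ∈ I.active T S, ∃ ρ, I.GoodRadius F x y S i ρ ∧ A = I.region x y T S i ρ ∧
    I.IsAllButMax (I.cut S A) Y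

/-- The while loop, started with current set `S`, may end after carving out the family `R` of
regions and adding the edge set `Z` to the solution. -/
inductive Loop (T : Set (Fin r)) : Set V → Set (Set V) → Set E → Prop
  | done (S : Set V) (h : I.active T S = ∅) : Loop T S ∅ ∅
  | step (S A : Set V) (Y : Set E) (R : Set (Set V)) (Z : Set E)
      (h : I.Step F x y T S A Y) (hl : Loop T (S \ A) R Z) : Loop T S (insert A R) (Y ∪ Z)

/-- `Z` is a possible output of the procedure on the node set `U` and the set `T` of pairs: run the
while loop from `S = U`, then recurse on every region `A` and the pairs contained in it. -/
inductive Output : Set V → Set (Fin r) → Set E → Prop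
  | mk (U : Set V) (T : Set (Fin r)) (R : Set (Set V)) (Z : Set E) (sub : Set V → Set E)
      (hl : I.Loop F x y T U R Z) (hr : ∀ A ∈ R, Output A (I.pairsIn T A) (sub A)) :
      Output U T (Z ∪ ⋃ A ∈ R, sub A)

/-- Every execution of the while loop from `S` comes to an end and never gets stuck: whichever pair
is picked there is an admissible radius, whatever the choices are. -/
inductive LoopHalts (T : Set (Fin r)) : Set V → Prop
  | intro (S : Set V) (h : ∀ i ∈ I.active T S, ∃ ρ, I.GoodRadius F x y S i ρ)
      (hs : ∀ A Y, I.Step F x y T S A Y → LoopHalts T (S \ A)) : LoopHalts T S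

/-- Every execution of the procedure on `U` and `T` comes to an end and never gets stuck. -/
inductive Halts : Set V → Set (Fin r) → Prop
  | intro (U : Set V) (T : Set (Fin r)) (hl : I.LoopHalts F x y T U)
      (hr : ∀ R Z, I.Loop F x y T U R Z → ∀ A ∈ R, Halts A (I.pairsIn T A)) : Halts U T

end Rounding

section Algorithm

variable {V E : Type*} [Fintype E] {r : ℕ} (I : MulticutInstance V E r)
  (x : E → ℝ) (y : Fin r → E → ℝ)

/-- `Z` is a possible output of 2-MCAlg with the LP solution `(x, y)`: an edge set of the subdivided
graph, returned by the initial call with all nodes and all pairs. -/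
def TwoMCAlgOutput (Z : Set (E × Fin (r + 1))) : Prop :=
  I.subdivide.Output (xEdges E r) (subX r x) (subY y) Set.univ Set.univ Z

/-- 2-MCAlg with the LP solution `(x, y)` always terminates and never gets stuck. -/
def TwoMCAlgHalts : Prop :=
  I.subdivide.Halts (xEdges E r) (subX r x) (subY y) Set.univ Set.univ

end Algorithm

end MulticutInstance

/-! After subdivision no edge carries both x- and y^i-length. `IsRoundable` keeps all that the
rounding needs: x lives on F, y^i lives off F with total at most 1, and every s_i-t_i walk has
length at least 1.

A good radius exists by two-sided region growing. Let N(ρ) count the cut edges outside F. Its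
integral over [0,1] is at most the total of y^i, hence at most 1. Where N(ρ) ≤ 1, the edge that c²
drops makes up for the one outside F, so c² is at most the cost p(ρ) of the cut x-edges, which is
the growth rate of the volume P. Put q(v) = ln(eK/v) with K = V^x(S), u = β + P(ρ) and v = β + P(1)
- P(ρ). Then -ln q(u) and ln q(v) increase at rates p/(u q(u)) and p/(v q(v)), each by at most L =
ln ln(e(r+1)) in total. If one of the two bounds failed wherever N ≤ 1, the rates would add up to
more than 4L there, while 2LN ≥ 4L elsewhere; integration gives 4L < L + L + 2L. This is
`exists_radius`, applied in `exists_goodRadius`.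

Each step leaves at most one edge between A and S \ A, so two edge-disjoint paths that survive lie
on one side (`EdgeConnected.side_of_cut_subsingleton`); feasibility follows by induction. A region
separates its pair, because the sink is at distance at least 1 > ρ, so S shrinks; a recursive call
has at most half of the pairs.

For the cost, let w be the x-weight of the edges of E(S) touching A. A step costs at most 4L(β+w)
ln(eV^x(S)/(β+w)). The β-part is at most β ln(e(r+1)) and is paid by the separated pair, which is in
no later call; over all r pairs this is OPT · ln(e(r+1)). The w-part telescopes along the recursion:
ln(V^x(S)/(β+w)) is the drop of a logarithmic potential, and the factor e costs 1 per level
(`charge_region`). With O(ln r) levels the sum is O(ln r) · OPT, times 4L. -/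

namespace Multigraph

/-! ### Walks, shortcuts and boundary crossings -/

variable {V E : Type*} {G : Multigraph V E}

theorem Joins.symm {e : E} {a b : V} (h : G.Joins e a b) : G.Joins e b a := Or.symm h

theorem joins_fst_snd (G : Multigraph V E) (e : E) : G.Joins e (G.fst e) (G.snd e) :=
  Or.inl ⟨rfl, rfl⟩

namespace Walk

def append : {a b d : V} → G.Walk a b → G.Walk b d → G.Walk a d
  | _, _, _, nil _, q => q
  | _, _, _, cons e h p, q => cons e h (p.append q)

theorem edges_append : {a b d : V} → (p : G.Walk a b) → (q : G.Walk b d) →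
    (p.append q).edges = p.edges ++ q.edges
  | _, _, _, nil _, q => rfl
  | _, _, _, cons e h p, q => by simp [append, edges, edges_append p q]

def reverse : {a b : V} → G.Walk a b → G.Walk b a
  | _, _, nil a => nil a
  | _, _, cons e h p => p.reverse.append (cons e h.symm (nil _))

theorem edges_reverse : {a b : V} → (p : G.Walk a b) → p.reverse.edges = p.edges.reverse
  | _, _, nil _ => rfl
  | _, _, cons e h p => by simp [reverse, edges, edges_append, edges_reverse p]

theorem length_append (w : E → ℝ) {a b d : V} (p : G.Walk a b) (q : G.Walk b d) :
    (p.append q).length w = p.length w + q.length w := by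
  simp [length, edges_append]

theorem length_reverse (w : E → ℝ) {a b : V} (p : G.Walk a b) :
    p.reverse.length w = p.length w := by
  simp [length, edges_reverse, List.sum_reverse]

theorem length_nonneg {w : E → ℝ} (hw : ∀ e, 0 ≤ w e) {a b : V} (p : G.Walk a b) :
    0 ≤ p.length w := by
  refine List.sum_nonneg fun t ht => ?_
  obtain ⟨e, -, rfl⟩ := List.mem_map.1 ht
  exact hw e

theorem start_mem_support : {a b : V} → (p : G.Walk a b) → a ∈ p.support
  | _, _, nil _ => by simp [support]
  | _, _, cons _ _ _ => by simp [support]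

/-- A simple path from any of its nodes to its end. -/
theorem exists_isPath_of_mem_support {a d : V} (p : G.Walk a d) (hp : p.IsPath) {u : V}
    (hu : u ∈ p.support) : ∃ q : G.Walk u d, q.IsPath ∧ q.edges.Sublist p.edges := by
  induction p with
  | nil a =>
    obtain rfl : u = a := by simpa [support] using hu
    exact ⟨nil u, hp, List.Sublist.refl _⟩
  | cons e h p ih =>
    rcases List.mem_cons.1 hu with rfl | hu
    · exact ⟨cons e h p, hp, List.Sublist.refl _⟩
    · obtain ⟨q, hq, hs⟩ := ih (List.nodup_cons.1 hp).2 hu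
      exact ⟨q, hq, hs.cons _⟩

/-- Every walk can be shortcut to a simple path. -/
theorem exists_isPath {a b : V} (p : G.Walk a b) :
    ∃ q : G.Walk a b, q.IsPath ∧ q.edges.Sublist p.edges := by
  induction p with
  | nil a => exact ⟨nil a, by simp [IsPath, support], List.Sublist.refl _⟩
  | @cons a b d e h p ih =>
    obtain ⟨q, hq, hs⟩ := ih
    by_cases ha : a ∈ q.support
    · obtain ⟨q', hq', hs'⟩ := q.exists_isPath_of_mem_support hq ha
      exact ⟨q', hq', (hs'.trans hs).cons _⟩
    · exact ⟨cons e h q, List.nodup_cons.2 ⟨ha, hq⟩, hs.cons_cons _⟩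

theorem length_le_of_sublist {w : E → ℝ} (hw : ∀ e, 0 ≤ w e) {a b a' b' : V} {p : G.Walk a b}
    {q : G.Walk a' b'} (h : q.edges.Sublist p.edges) : q.length w ≤ p.length w := by
  refine (h.map w).sum_le_sum fun t ht => ?_
  obtain ⟨e, -, rfl⟩ := List.mem_map.1 ht
  exact hw e

theorem mem_support_of_joins {a b : V} (p : G.Walk a b) {e : E} (he : e ∈ p.edges) {u v : V}
    (h : G.Joins e u v) : u ∈ p.support := by
  induction p with
  | nil a => simp [edges] at he
  | @cons a b d f hf p ih =>
    rcases List.mem_cons.1 he with rfl | he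
    · have hb := p.start_mem_support
      have : u = a ∨ u = b := by
        rcases h with ⟨rfl, rfl⟩ | ⟨rfl, rfl⟩ <;> rcases hf with ⟨h1, h2⟩ | ⟨h1, h2⟩ <;> simp [*]
      rcases this with rfl | rfl
      · exact List.mem_cons_self
      · exact List.mem_cons_of_mem _ hb
    · exact List.mem_cons_of_mem _ (ih he)

theorem IsPath.edges_nodup {a b : V} {p : G.Walk a b} (hp : p.IsPath) : p.edges.Nodup := by
  induction p with
  | nil a => exact List.nodup_nil
  | @cons a b d f hf p ih =>
    have hp' := List.nodup_cons.1 hp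
    exact List.nodup_cons.2 ⟨fun h => hp'.1 (p.mem_support_of_joins h hf), ih hp'.2⟩

theorem ends_mem_of_edgesIn {S : Set V} {a b : V} (p : G.Walk a b) (hab : a ≠ b)
    (hp : ∀ e ∈ p.edges, e ∈ G.edgesIn S) : a ∈ S ∧ b ∈ S := by
  induction p with
  | nil a => exact absurd rfl hab
  | @cons a b d f hf p ih =>
    have hfS : f ∈ G.edgesIn S := hp f List.mem_cons_self
    have h : a ∈ S ∧ b ∈ S := by
      rcases hf with ⟨rfl, rfl⟩ | ⟨rfl, rfl⟩
      exacts [hfS, hfS.symm]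
    refine ⟨h.1, ?_⟩
    by_cases hbd : b = d
    · exact hbd ▸ h.2
    · exact (ih hbd fun e he => hp e (List.mem_cons_of_mem _ he)).2

/-- A walk inside `S` with exactly one end in `A` crosses the boundary of `A`. -/
theorem exists_mem_cut {S A : Set V} {a b : V} (p : G.Walk a b)
    (hp : ∀ e ∈ p.edges, e ∈ G.edgesIn S) (hab : ¬ (a ∈ A ↔ b ∈ A)) :
    ∃ e ∈ p.edges, e ∈ G.cut S A := by
  induction p with
  | nil a => exact absurd Iff.rfl hab
  | @cons a b d f hf p ih =>
    by_cases hd : b ∈ A ↔ d ∈ A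
    · refine ⟨f, List.mem_cons_self, ?_⟩
      have hfS : f ∈ G.edgesIn S := hp f List.mem_cons_self
      rw [← hd] at hab
      simp only [edgesIn, cut, Set.mem_ofPred_eq, Set.mem_sdiff] at hfS ⊢
      rcases hf with ⟨rfl, rfl⟩ | ⟨rfl, rfl⟩ <;> tauto
    · obtain ⟨e, he, hc⟩ := ih (fun e he => hp e (List.mem_cons_of_mem _ he)) hd
      exact ⟨e, List.mem_cons_of_mem _ he, hc⟩

/-- A simple path inside `S` with both ends in `A` that may use only one boundary edge of `A` stays
in `A`. -/
theorem edgesIn_of_cut_subsingleton {S A : Set V} {a b : V} (p : G.Walk a b)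
    (hp : ∀ e ∈ p.edges, e ∈ G.edgesIn S) (hn : p.edges.Nodup)
    (hc : ∀ e ∈ p.edges, ∀ f ∈ p.edges, e ∈ G.cut S A → f ∈ G.cut S A → e = f)
    (ha : a ∈ A) (hb : b ∈ A) : ∀ e ∈ p.edges, e ∈ G.edgesIn A := by
  induction p with
  | nil a => simp [edges]
  | @cons a u d f hf p ih =>
    have hpt : ∀ e ∈ p.edges, e ∈ G.edgesIn S := fun e he => hp e (List.mem_cons_of_mem _ he)
    have hn' := List.nodup_cons.1 hn
    have hu : u ∈ A := by
      -- A path that leaves A through f has to return to its end in A; the boundary edge used for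
      -- that would again be f, which is not repeated.
      by_contra hu
      have h1 : f ∈ G.cut S A := by
        obtain ⟨e, he, hce⟩ := (cons f hf (nil u)).exists_mem_cut (S := S) (A := A)
          (by simpa [edges] using hp f List.mem_cons_self) (by tauto)
        obtain rfl : e = f := by simpa [edges] using he
        exact hce
      obtain ⟨e, he, hce⟩ := p.exists_mem_cut hpt (A := A) (by tauto)
      exact hn'.1 (hc f List.mem_cons_self e (List.mem_cons_of_mem _ he) h1 hce ▸ he)
    intro e he
    rcases List.mem_cons.1 he with rfl | he
    · rcases hf with ⟨rfl, rfl⟩ | ⟨rfl, rfl⟩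
      exacts [⟨ha, hu⟩, ⟨hu, ha⟩]
    · exact ih hpt hn'.2 (fun e he f hf => hc e (List.mem_cons_of_mem _ he) f
        (List.mem_cons_of_mem _ hf)) hu hb e he

end Walk

/-! ### Edge connectivity across a cut with at most one remaining edge -/

theorem EdgeConnected.mono {D D' : Set E} {k : ℕ} {a b : V} (h : G.EdgeConnected D k a b)
    (hD : D ⊆ D') : G.EdgeConnected D' k a b := by
  obtain ⟨P, h1, h2, h3⟩ := h
  exact ⟨P, h1, fun j e he => hD (h2 j e he), h3⟩

theorem EdgeConnected.ends_mem {S : Set V} {k : ℕ} (hk : k ≠ 0) {a b : V}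
    (h : G.EdgeConnected (G.edgesIn S) k a b) (hab : a ≠ b) : a ∈ S ∧ b ∈ S := by
  obtain ⟨P, -, h2, -⟩ := h
  exact (P ⟨0, Nat.pos_of_ne_zero hk⟩).ends_mem_of_edgesIn hab (h2 _)

/-- Walks with pairwise disjoint prescribed edge sets suffice for edge connectivity. -/
theorem EdgeConnected.of_walks {D : Set E} {k : ℕ} {a b : V} (P : Fin k → G.Walk a b)
    (hD : ∀ j, ∀ e ∈ (P j).edges, e ∈ D)
    (hd : ∀ j j', j ≠ j' → List.Disjoint (P j).edges (P j').edges) : G.EdgeConnected D k a b := by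
  choose Q hQ hs using fun j => (P j).exists_isPath
  exact ⟨Q, hQ, fun j e he => hD j e ((hs j).subset he), fun j j' hj e he he' =>
    hd j j' hj ((hs j).subset he) ((hs j').subset he')⟩

/-- If `S` is split into `A` and `S \ A`, joined by at most one edge of `D`, then two edge-disjoint
paths in `D` lie on one side. -/
theorem EdgeConnected.side_of_cut_subsingleton {S A : Set V} {D : Set E}
    (hDS : D ⊆ G.edgesIn S) (hcut : (D ∩ G.cut S A).Subsingleton) {a b : V} (hab : a ≠ b)
    (h : G.EdgeConnected D 2 a b) :
    (a ∈ A ∧ b ∈ A ∧ G.EdgeConnected (D ∩ G.edgesIn A) 2 a b) ∨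
      G.EdgeConnected (D ∩ G.edgesIn (S \ A)) 2 a b := by
  obtain ⟨haS, hbS⟩ := (h.mono hDS).ends_mem two_ne_zero hab
  obtain ⟨P, h1, h2, h3⟩ := h
  by_cases hiff : a ∈ A ↔ b ∈ A
  · by_cases ha : a ∈ A
    · refine Or.inl ⟨ha, hiff.1 ha, P, h1, fun j e he => ⟨h2 j e he, ?_⟩, h3⟩
      exact (P j).edgesIn_of_cut_subsingleton (fun e he => hDS (h2 j e he)) (h1 j).edges_nodup
        (fun e he f hf hec hfc => hcut ⟨h2 j e he, hec⟩ ⟨h2 j f hf, hfc⟩) ha (hiff.1 ha) e he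
    · refine Or.inr ⟨P, h1, fun j e he => ⟨h2 j e he, ?_⟩, h3⟩
      have hsub : ∀ e, e ∈ G.cut S (S \ A) → e ∈ D → e ∈ G.cut S A := by
        intro e hec heD
        have := hDS heD
        simp only [cut, edgesIn, Set.mem_ofPred_eq, Set.mem_sdiff] at hec this ⊢
        tauto
      exact (P j).edgesIn_of_cut_subsingleton (fun e he => hDS (h2 j e he)) (h1 j).edges_nodup
        (fun e he f hf hec hfc => hcut ⟨h2 j e he, hsub e hec (h2 j e he)⟩
          ⟨h2 j f hf, hsub f hfc (h2 j f hf)⟩) ⟨haS, ha⟩ ⟨hbS, fun hb => ha (hiff.2 hb)⟩ e he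
  -- With the ends on different sides, both paths would need the single crossing edge.
  · exfalso
    obtain ⟨e, he, hec⟩ := (P 0).exists_mem_cut (fun e he => hDS (h2 0 e he)) hiff
    obtain ⟨f, hf, hfc⟩ := (P 1).exists_mem_cut (fun e he => hDS (h2 1 e he)) hiff
    exact h3 0 1 (by decide) he (hcut ⟨h2 0 e he, hec⟩ ⟨h2 1 f hf, hfc⟩ ▸ hf)

/-! ### Shortest-path distances and their truncation -/

section Distance

variable {w : E → ℝ}

theorem edist_le {a b : V} (p : G.Walk a b) : G.edist w a b ≤ ENNReal.ofReal (p.length w) :=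
  iInf_le _ p

theorem edist_self (G : Multigraph V E) (w : E → ℝ) (a : V) : G.edist w a a = 0 :=
  le_antisymm ((edist_le (Walk.nil a)).trans (by simp [Walk.length, Walk.edges])) zero_le

theorem edist_comm (G : Multigraph V E) (w : E → ℝ) (a b : V) :
    G.edist w a b = G.edist w b a := by
  have key : ∀ a b, G.edist w a b ≤ G.edist w b a := fun a b =>
    le_iInf fun p => (edist_le p.reverse).trans (by rw [Walk.length_reverse])
  exact le_antisymm (key a b) (key b a)

theorem edist_triangle (hw : ∀ e, 0 ≤ w e) (a b d : V) :
    G.edist w a d ≤ G.edist w a b + G.edist w b d := by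
  refine ENNReal.le_iInf_add_iInf fun p q => (edist_le (p.append q)).trans ?_
  rw [Walk.length_append, ENNReal.ofReal_add (p.length_nonneg hw) (q.length_nonneg hw)]

theorem edist_le_of_joins {e : E} {a b : V} (h : G.Joins e a b) :
    G.edist w a b ≤ ENNReal.ofReal (w e) :=
  (edist_le (Walk.cons e h (Walk.nil b))).trans (by simp [Walk.length, Walk.edges])

theorem edist_ends_le (G : Multigraph V E) (w : E → ℝ) (e : E) :
    G.edist w (G.fst e) (G.snd e) ≤ ENNReal.ofReal (w e) :=
  edist_le_of_joins (G.joins_fst_snd e)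

theorem dist_ends_le (G : Multigraph V E) (hw : ∀ e, 0 ≤ w e) (e : E) :
    G.dist w (G.fst e) (G.snd e) ≤ w e :=
  ENNReal.toReal_le_of_le_ofReal (hw e) (G.edist_ends_le w e)

/-- The distance from `z`, truncated at `1`. -/
noncomputable def truncDist (G : Multigraph V E) (w : E → ℝ) (z a : V) : ℝ :=
  (min (G.edist w z a) 1).toReal

theorem truncDist_nonneg (z a : V) : 0 ≤ G.truncDist w z a := ENNReal.toReal_nonneg

theorem truncDist_le_one (z a : V) : G.truncDist w z a ≤ 1 :=
  ENNReal.toReal_le_of_le_ofReal zero_le_one (by simp)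

theorem truncDist_self (z : V) : G.truncDist w z z = 0 := by simp [truncDist, edist_self]

/-- Truncation at 1 does not affect balls of radius below 1, and it provides a finite real distance
even between components. -/
theorem mem_ball_iff {z a : V} {ρ : ℝ} (h0 : 0 ≤ ρ) (h1 : ρ < 1) :
    a ∈ G.ball w z ρ ↔ G.truncDist w z a ≤ ρ := by
  have hm : min (G.edist w z a) 1 ≠ ⊤ := ((min_le_right _ _).trans_lt ENNReal.one_lt_top).ne
  have h1' : ENNReal.ofReal ρ < 1 := by rwa [ENNReal.ofReal_lt_one]
  rw [truncDist, ← ENNReal.le_ofReal_iff_toReal_le hm h0, min_le_iff, or_iff_left h1'.not_ge]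
  rfl

theorem truncDist_le_dist {z a : V} (h : G.edist w z a ≠ ⊤) :
    G.truncDist w z a ≤ G.dist w z a :=
  ENNReal.toReal_mono h (min_le_left _ _)

theorem truncDist_eq_dist {z a : V} (h : G.truncDist w z a < 1) :
    G.truncDist w z a = G.dist w z a := by
  have : G.edist w z a ≤ 1 := by
    by_contra hlt
    rw [truncDist, min_eq_right (not_le.1 hlt).le] at h
    simp at h
  rw [truncDist, min_eq_left this, dist]

theorem truncDist_le_add (hw : ∀ e, 0 ≤ w e) (z : V) {a b : V} (hab : G.edist w a b ≠ ⊤) :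
    G.truncDist w z b ≤ G.truncDist w z a + G.dist w a b := by
  have hm : min (G.edist w z a) 1 ≠ ⊤ := ((min_le_right _ _).trans_lt ENNReal.one_lt_top).ne
  rw [truncDist, truncDist, dist, ← ENNReal.toReal_add hm hab]
  refine ENNReal.toReal_mono (ENNReal.add_ne_top.2 ⟨hm, hab⟩) ?_
  rw [min_add]
  exact le_min ((min_le_left _ _).trans (edist_triangle hw z a b))
    ((min_le_right _ _).trans le_self_add)

theorem abs_truncDist_sub_le_dist (hw : ∀ e, 0 ≤ w e) (z : V) (e : E) :
    |G.truncDist w z (G.fst e) - G.truncDist w z (G.snd e)| ≤ G.dist w (G.fst e) (G.snd e) := by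
  have hf : G.edist w (G.fst e) (G.snd e) ≠ ⊤ :=
    ((G.edist_ends_le w e).trans_lt ENNReal.ofReal_lt_top).ne
  have h1 := truncDist_le_add hw z hf
  have h2 := truncDist_le_add hw z (G.edist_comm w _ _ ▸ hf)
  rw [dist, edist_comm, ← dist] at h2
  exact abs_sub_le_iff.2 ⟨by linarith, by linarith⟩

theorem abs_truncDist_sub_le (hw : ∀ e, 0 ≤ w e) (z : V) (e : E) :
    |G.truncDist w z (G.fst e) - G.truncDist w z (G.snd e)| ≤ w e :=
  (abs_truncDist_sub_le_dist hw z e).trans (G.dist_ends_le hw e)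

/-- A function that is `1`-Lipschitz along all edges bounds the lengths of walks from below. -/
theorem Walk.sub_le_length {f : V → ℝ} (hf : ∀ e, |f (G.fst e) - f (G.snd e)| ≤ w e) {a b : V}
    (p : G.Walk a b) : f b - f a ≤ p.length w := by
  induction p with
  | nil a => simp [Walk.length, Walk.edges]
  | @cons a u d e h p ih =>
    have := abs_le.1 (hf e)
    have hl : (Walk.cons e h p).length w = w e + p.length w := by simp [Walk.length, Walk.edges]
    rw [hl]
    rcases h with ⟨rfl, rfl⟩ | ⟨rfl, rfl⟩ <;> linarith

theorem truncDist_eq_one {a b : V} (h : ∀ p : G.Walk a b, 1 ≤ p.length w) :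
    G.truncDist w a b = 1 := by
  have : 1 ≤ G.edist w a b := le_iInf fun p => by simpa using ENNReal.ofReal_le_ofReal (h p)
  simp [truncDist, min_eq_right this]

end Distance

end Multigraph

namespace MulticutInstance

/-! ### From the linear program to the subdivided graph -/

section Roundable

variable {V E : Type*} [Fintype E] {r : ℕ}

/-- The properties of a fractional solution on which the rounding procedure relies: `x` lives on
`F`, the `y^i` live off `F` and have total value at most `1`, and the sinks are at distance at
least `1` from their sources. -/
structure IsRoundable (I : MulticutInstance V E r) (F : Set E) (x : E → ℝ)
    (y : Fin r → E → ℝ) : Prop where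
  x_nonneg : ∀ e, 0 ≤ x e
  y_nonneg : ∀ i e, 0 ≤ y i e
  x_eq_zero : ∀ e, e ∉ F → x e = 0
  y_eq_zero : ∀ i e, e ∈ F → y i e = 0
  budget : ∀ i, ∑ e, y i e ≤ 1
  walk : ∀ i, ∀ P : I.Walk (I.source i) (I.sink i), 1 ≤ P.length (fun e => x e + y i e)

end Roundable

section Subdivision

variable {V E : Type*} {r : ℕ} (I : MulticutInstance V E r)

theorem subNode_zero (e : E) : I.subNode e 0 = Sum.inl (I.fst e) := rfl

theorem subNode_last (e : E) : I.subNode e (Fin.last (r + 1)) = Sum.inl (I.snd e) := by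
  rw [← Fin.succ_last]
  simp only [subNode, Fin.cases_succ, Fin.lastCases_last]

theorem subNode_castSucc_succ (e : E) (m : Fin r) :
    I.subNode e m.castSucc.succ = Sum.inr (e, m) := by
  simp [subNode]

/-- The total length of the first `k` edges of the subdivision of `e`. -/
def subPrefix (x : E → ℝ) (y : Fin r → E → ℝ) (i : Fin r) (e : E) (k : ℕ) : ℝ :=
  (if 1 ≤ k then x e else 0) + if (i : ℕ) + 2 ≤ k then y i e else 0

theorem subPrefix_zero (x : E → ℝ) (y : Fin r → E → ℝ) (i : Fin r) (e : E) :
    subPrefix x y i e 0 = 0 := by simp [subPrefix]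

theorem subPrefix_last (x : E → ℝ) (y : Fin r → E → ℝ) (i : Fin r) (e : E) :
    subPrefix x y i e (r + 1) = x e + y i e := by
  have : (i : ℕ) + 2 ≤ r + 1 := by omega
  simp [subPrefix, this]

theorem subPrefix_succ (x : E → ℝ) (y : Fin r → E → ℝ) (i : Fin r) (e : E) (j : Fin (r + 1)) :
    subPrefix x y i e (j + 1) = subPrefix x y i e j + (subX r x (e, j) + subY y i (e, j)) := by
  have h0 : (j = 0) ↔ (j : ℕ) = 0 := Fin.ext_iff
  have h1 : (j = i.succ) ↔ (j : ℕ) = i + 1 := by simp [Fin.ext_iff]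
  simp only [subPrefix, subX, subY, h0, h1]
  split_ifs <;> first | omega | simp

/-- Extension of a function on the nodes to the nodes of the subdivision. -/
noncomputable def subPotential (x : E → ℝ) (y : Fin r → E → ℝ) (i : Fin r) (d : V → ℝ) :
    V ⊕ E × Fin r → ℝ
  | Sum.inl v => d v
  | Sum.inr (e, m) => min (d (I.fst e) + subPrefix x y i e (m + 1))
      (d (I.snd e) + (x e + y i e - subPrefix x y i e (m + 1)))

/-- The Lipschitz bound along e makes the minimum equal to the value of d at either end, so one
formula serves old and new nodes. -/
theorem subPotential_subNode {x : E → ℝ} {y : Fin r → E → ℝ} {i : Fin r} {d : V → ℝ}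
    (hd : ∀ e, |d (I.fst e) - d (I.snd e)| ≤ x e + y i e) (e : E) (j : Fin (r + 2)) :
    I.subPotential x y i d (I.subNode e j) = min (d (I.fst e) + subPrefix x y i e j)
      (d (I.snd e) + (x e + y i e - subPrefix x y i e j)) := by
  have hde := abs_le.1 (hd e)
  induction j using Fin.cases with
  | zero =>
    rw [subNode_zero, subPotential, Fin.val_zero, subPrefix_zero, min_eq_left] <;> linarith
  | succ j =>
    induction j using Fin.lastCases with
    | last =>
      rw [Fin.succ_last, subNode_last, subPotential, Fin.val_last, subPrefix_last, min_eq_right]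
        <;> linarith
    | cast m =>
      rw [subNode_castSucc_succ, subPotential]
      simp

/-- Along e_j both alternatives of the minimum change by exactly the length of e_j, and a minimum
changes by no more than its arguments. -/
theorem abs_subPotential_sub_le {x : E → ℝ} {y : Fin r → E → ℝ} {i : Fin r} {d : V → ℝ}
    (hd : ∀ e, |d (I.fst e) - d (I.snd e)| ≤ x e + y i e) (hx : ∀ e, 0 ≤ x e)
    (hy : ∀ e, 0 ≤ y i e) (f : E × Fin (r + 1)) :
    |I.subPotential x y i d (I.subdivide.fst f) - I.subPotential x y i d (I.subdivide.snd f)|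
      ≤ subX r x f + subY y i f := by
  obtain ⟨e, j⟩ := f
  have hn : 0 ≤ subX r x (e, j) + subY y i (e, j) := by
    refine add_nonneg ?_ ?_ <;> simp only [subX, subY] <;> split_ifs <;> simp [hx, hy]
  change |I.subPotential x y i d (I.subNode e j.castSucc)
    - I.subPotential x y i d (I.subNode e j.succ)| ≤ _
  rw [subPotential_subNode I hd, subPotential_subNode I hd]
  refine (abs_min_sub_min_le_max _ _ _ _).trans (max_le ?_ ?_) <;>
    rw [Fin.val_castSucc, Fin.val_succ, subPrefix_succ, abs_le] <;> constructor <;> linarith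

/-- A feasible LP solution, put on the subdivided graph, can be rounded. -/
theorem IsLPFeasible.isRoundable [Fintype E] {x : E → ℝ} {y : Fin r → E → ℝ}
    (h : I.IsLPFeasible 2 x y) :
    I.subdivide.IsRoundable (xEdges E r) (subX r x) (subY y) where
  x_nonneg f := by simp only [subX]; split_ifs <;> simp [h.x_nonneg]
  y_nonneg i f := by simp only [subY]; split_ifs <;> simp [h.y_nonneg]
  x_eq_zero f hf := if_neg hf
  y_eq_zero i f hf := if_neg (by rw [show f.2 = 0 from hf]; exact (Fin.succ_ne_zero i).symm)
  budget i := by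
    rw [Fintype.sum_prod_type]
    have := h.budget i
    simp only [subY, Finset.sum_ite_eq', Finset.mem_univ, if_true]
    norm_num at this ⊢
    exact this
  walk i P := by
    have hw : ∀ e, 0 ≤ x e + y i e := fun e => add_nonneg (h.x_nonneg e) (h.y_nonneg i e)
    -- The extended truncated distance is a 1-Lipschitz potential on the subdivision, 0 at the
    -- source and 1 at the sink; so walks of the subdivision need not be projected to the original
    -- graph.
    have hL := Multigraph.Walk.sub_le_length
      (I.abs_subPotential_sub_le (d := I.truncDist (fun e => x e + y i e) (I.source i))
        (Multigraph.abs_truncDist_sub_le hw _) h.x_nonneg (h.y_nonneg i)) P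
    have h1 : I.truncDist (fun e => x e + y i e) (I.source i) (I.sink i) = 1 := by
      refine Multigraph.truncDist_eq_one fun p => ?_
      obtain ⟨q, hq, hs⟩ := p.exists_isPath
      exact (h.path i q hq).trans (Multigraph.Walk.length_le_of_sublist hw hs)
    simp only [subdivide, subPotential, h1, Multigraph.truncDist_self, sub_zero] at hL
    exact hL

theorem lpValue_subdivide [Fintype E] (x : E → ℝ) :
    I.subdivide.lpValue (subX r x) = I.lpValue x := by
  simp [lpValue, Fintype.sum_prod_type, subX, subdivide]

theorem costOf_unsubdivide_le [Fintype E] (Z : Set (E × Fin (r + 1))) :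
    I.costOf (unsubdivide Z) ≤ I.subdivide.costOf Z := by
  classical
  rw [costOf, costOf, Fintype.sum_prod_type]
  refine Finset.sum_le_sum fun e _ => ?_
  have hnn : ∀ f, 0 ≤ Z.indicator I.subdivide.cost f :=
    fun f => Set.indicator_nonneg (fun f _ => I.subdivide.cost_nonneg f) f
  by_cases he : e ∈ unsubdivide Z
  · rw [Set.indicator_of_mem he]
    obtain ⟨⟨e, j⟩, hf, rfl⟩ := he
    refine le_trans (le_of_eq ?_)
      (Finset.single_le_sum (fun j _ => hnn (e, j)) (Finset.mem_univ j))
    rw [Set.indicator_of_mem hf]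
    rfl
  · rw [Set.indicator_of_notMem he]
    exact Finset.sum_nonneg fun j _ => hnn (e, j)

theorem exists_subdivide_walk_subNode (e : E) (k : Fin (r + 2)) :
    ∃ p : I.subdivide.Walk (I.subNode e 0) (I.subNode e k), ∀ f ∈ p.edges, f.1 = e := by
  induction k using Fin.induction with
  | zero => exact ⟨.nil _, by simp [Multigraph.Walk.edges]⟩
  | succ k ih =>
    obtain ⟨p, hp⟩ := ih
    refine ⟨p.append (.cons (e, k) (I.subdivide.joins_fst_snd (e, k)) (.nil _)), fun f hf => ?_⟩
    rw [Multigraph.Walk.edges_append, List.mem_append] at hf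
    rcases hf with hf | hf
    · exact hp f hf
    · obtain rfl : f = (e, k) := by simpa [Multigraph.Walk.edges] using hf
      rfl

theorem exists_subdivide_walk_of_joins {e : E} {a b : V} (h : I.Joins e a b) :
    ∃ p : I.subdivide.Walk (Sum.inl a) (Sum.inl b), ∀ f ∈ p.edges, f.1 = e := by
  have key : ∃ p : I.subdivide.Walk (Sum.inl (I.fst e)) (Sum.inl (I.snd e)),
      ∀ f ∈ p.edges, f.1 = e := by
    have := I.exists_subdivide_walk_subNode e (Fin.last (r + 1))
    rwa [subNode_last, subNode_zero] at this
  obtain ⟨p, hp⟩ := key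
  rcases h with ⟨rfl, rfl⟩ | ⟨rfl, rfl⟩
  · exact ⟨p, hp⟩
  · exact ⟨p.reverse, fun f hf => hp f (by simpa [Multigraph.Walk.edges_reverse] using hf)⟩

theorem exists_subdivide_walk {a b : V} (p : I.Walk a b) :
    ∃ q : I.subdivide.Walk (Sum.inl a) (Sum.inl b), ∀ f ∈ q.edges, f.1 ∈ p.edges := by
  induction p with
  | nil a => exact ⟨.nil _, by simp [Multigraph.Walk.edges]⟩
  | cons e h p ih =>
    obtain ⟨q, hq⟩ := ih
    obtain ⟨q', hq'⟩ := I.exists_subdivide_walk_of_joins h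
    refine ⟨q'.append q, fun f hf => ?_⟩
    rw [Multigraph.Walk.edges_append, List.mem_append] at hf
    rcases hf with hf | hf
    · simp [Multigraph.Walk.edges, hq' f hf]
    · simp [Multigraph.Walk.edges, hq f hf]

theorem IsFeasible.unsubdivide {k : ℕ} {Z : Set (E × Fin (r + 1))}
    (h : I.subdivide.IsFeasible k Z) : I.IsFeasible k (unsubdivide Z) := by
  rintro i ⟨P, -, h2, h3⟩
  choose Q hQ using fun j => I.exists_subdivide_walk (P j)
  exact h i (.of_walks Q (fun j f hf hZ => h2 j f.1 (hQ j f hf) ⟨f, hZ, rfl⟩)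
    fun j j' hj f hf hf' => h3 j j' hj (hQ j f hf) (hQ j' f hf'))

end Subdivision

end MulticutInstance

/-! ### The averaging argument with right derivatives -/

section RightDerivative

open Set Filter Topology

theorem hasDerivWithinAt_min_const (h ρ : ℝ) :
    HasDerivWithinAt (fun t => min t h) (if ρ < h then 1 else 0) (Ici ρ) ρ := by
  split_ifs with hlt
  · refine ((hasDerivAt_id ρ).congr_of_eventuallyEq ?_).hasDerivWithinAt
    filter_upwards [Iio_mem_nhds hlt] with t ht
    exact min_eq_left (le_of_lt ht)
  · exact (hasDerivWithinAt_const ρ (Ici ρ) h).congr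
      (fun t ht => min_eq_right ((not_lt.1 hlt).trans ht)) (min_eq_right (not_lt.1 hlt))

/-- Monotonicity comes from the sign of the right derivative; strictness from a point just to the
right of t where g already exceeds g t. The strict form is needed because the upper and lower
estimates in `exists_radius` meet exactly. -/
theorem lt_of_right_deriv_nonneg_of_pos {g g' : ℝ → ℝ} {a b t : ℝ}
    (hg : ContinuousOn g (Icc a b))
    (hg' : ∀ s ∈ Ico a b, HasDerivWithinAt g (g' s) (Ici s) s) (h0 : ∀ s ∈ Ico a b, 0 ≤ g' s)
    (ht : t ∈ Ico a b) (hpos : 0 < g' t) : g a < g b := by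
  have mono : ∀ u v, a ≤ u → u ≤ v → v ≤ b → g u ≤ g v := by
    intro u v hu huv hv
    exact image_le_of_deriv_right_le_deriv_boundary (f := fun _ => g u) (f' := fun _ => 0)
      continuousOn_const (fun s _ => hasDerivWithinAt_const s _ _) le_rfl
      (hg.mono (Icc_subset_Icc hu hv))
      (fun s hs => hg' s ⟨hu.trans hs.1, hs.2.trans_le hv⟩)
      (fun s hs => h0 s ⟨hu.trans hs.1, hs.2.trans_le hv⟩) (right_mem_Icc.2 huv)
  have hslope : ∀ᶠ s in 𝓝[>] t, 0 < slope g t s :=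
    ((hasDerivWithinAt_iff_tendsto_slope' self_notMem_Ioi).1
      (hasDerivWithinAt_Ioi_iff_Ici.2 (hg' t ht))).eventually (lt_mem_nhds hpos)
  obtain ⟨s, hs, hsb⟩ := (hslope.and (Ioo_mem_nhdsGT ht.2)).exists
  have : g t < g s := by
    rw [slope_def_field, div_pos_iff_of_pos_right (sub_pos.2 hsb.1)] at hs
    linarith
  exact (mono a t le_rfl ht.1 ht.2.le).trans_lt
    (this.trans_le (mono s b (ht.1.trans hsb.1.le) hsb.2.le le_rfl))

/-- Otherwise the integer N is at least 2 throughout, and comparison with 2s gives M 1 ≥ 2. -/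
theorem exists_count_le_one {M : ℝ → ℝ} {N : ℝ → ℕ} (hM : ContinuousOn M (Icc 0 1))
    (hM' : ∀ s ∈ Ico (0 : ℝ) 1, HasDerivWithinAt M (N s) (Ici s) s)
    (hM0 : M 0 = 0) (hM1 : M 1 ≤ 1) : ∃ t ∈ Ico (0 : ℝ) 1, N t ≤ 1 := by
  by_contra! hN
  have := image_le_of_deriv_right_le_deriv_boundary (f := fun s => 2 * s) (f' := fun _ => 2)
    (by fun_prop) (fun s _ => by simpa using ((hasDerivAt_id s).const_mul 2).hasDerivWithinAt)
    (by simp [hM0]) hM hM'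
    (fun s hs => by exact_mod_cast hN s hs) (right_mem_Icc.2 zero_le_one)
  norm_num at this
  linarith

/-- The averaging argument of region growing, for two-sided volumes `β + P ρ` and
`β + P 1 - P ρ` and a counting function `N` of average at most `1`. -/
theorem exists_radius {P p M : ℝ → ℝ} {N : ℝ → ℕ} {β K R : ℝ}
    (hP : ContinuousOn P (Icc 0 1)) (hP' : ∀ s ∈ Ico (0 : ℝ) 1, HasDerivWithinAt P (p s) (Ici s) s)
    (hM : ContinuousOn M (Icc 0 1))
    (hM' : ∀ s ∈ Ico (0 : ℝ) 1, HasDerivWithinAt M (N s) (Ici s) s)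
    (hp : ∀ s, 0 ≤ p s) (hP0 : ∀ s ∈ Icc (0 : ℝ) 1, 0 ≤ P s ∧ P s ≤ P 1)
    (hM0 : M 0 = 0) (hM1 : M 1 ≤ 1) (hβ : 0 < β) (hK : β + P 1 ≤ K) (hR : K ≤ R * β) :
    ∃ ρ ∈ Ico (0 : ℝ) 1, N ρ ≤ 1 ∧
      p ρ ≤ 4 * (β + P ρ) * Real.log (Real.exp 1 * K / (β + P ρ)) *
        Real.log (Real.log (Real.exp 1 * R)) ∧
      p ρ ≤ 4 * (β + (P 1 - P ρ)) * Real.log (Real.exp 1 * K / (β + (P 1 - P ρ))) *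
        Real.log (Real.log (Real.exp 1 * R)) := by
  have hK0 : 0 < K := by have := hP0 1 (by simp); linarith
  have hR0 : 0 < R := pos_of_mul_pos_left (hK0.trans_le hR) hβ.le
  have hlogR : Real.log (Real.exp 1 * R) = 1 + Real.log R := by
    rw [Real.log_mul (Real.exp_ne_zero _) hR0.ne', Real.log_exp]
  set L := Real.log (Real.log (Real.exp 1 * R)) with hL
  -- Here q v = ln(eK/v), with 1 ≤ q v ≤ ln(eR) for β ≤ v ≤ K; hence 0 ≤ ln (q v) ≤ L.
  set q : ℝ → ℝ := fun v => 1 + Real.log K - Real.log v with hq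
  have hlog : ∀ v, 0 < v → Real.log (Real.exp 1 * K / v) = q v := by
    intro v hv
    rw [Real.log_div (by positivity) hv.ne', Real.log_mul (Real.exp_ne_zero _) hK0.ne',
      Real.log_exp]
  have hq1 : ∀ v, 0 < v → v ≤ K → 1 ≤ q v := by
    intro v hv hvK
    have := Real.log_le_log hv hvK
    simp only [hq]; linarith
  have hq2 : ∀ v, β ≤ v → q v ≤ 1 + Real.log R := by
    intro v hv
    have h1 := Real.log_le_log hβ hv
    have h2 := Real.log_le_log hK0 hR
    rw [Real.log_mul hR0.ne' hβ.ne'] at h2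
    simp only [hq]; linarith
  have hlq0 : ∀ v, 0 < v → v ≤ K → 0 ≤ Real.log (q v) :=
    fun v hv hvK => Real.log_nonneg (hq1 v hv hvK)
  have hlqL : ∀ v, β ≤ v → v ≤ K → Real.log (q v) ≤ L := by
    intro v hv hvK
    rw [hL, hlogR]
    exact Real.log_le_log (one_pos.trans_le (hq1 v (hβ.trans_le hv) hvK)) (hq2 v hv)
  have hβK : β ≤ K := by have := hP0 1 (by simp); linarith
  have hL0 : 0 ≤ L := (hlq0 β hβ hβK).trans (hlqL β le_rfl hβK)
  obtain ⟨t, ht, hNt⟩ := exists_count_le_one hM hM' hM0 hM1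
  by_contra! hbad
  set u : ℝ → ℝ := fun s => β + P s with hu
  set v : ℝ → ℝ := fun s => β + (P 1 - P s) with hv
  have hub : ∀ s ∈ Icc (0 : ℝ) 1, β ≤ u s ∧ u s ≤ K := fun s hs => by
    have := hP0 s hs; simp only [hu]; constructor <;> linarith
  have hvb : ∀ s ∈ Icc (0 : ℝ) 1, β ≤ v s ∧ v s ≤ K := fun s hs => by
    have := hP0 s hs; simp only [hv]; constructor <;> linarith
  have hu' : ∀ s ∈ Ico (0 : ℝ) 1, HasDerivWithinAt u (p s) (Ici s) s :=
    fun s hs => (hP' s hs).const_add β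
  have hv' : ∀ s ∈ Ico (0 : ℝ) 1, HasDerivWithinAt v (-p s) (Ici s) s :=
    fun s hs => ((hP' s hs).const_sub (P 1)).const_add β
  have huc : ContinuousOn u (Icc 0 1) := continuousOn_const.add hP
  have hvc : ContinuousOn v (Icc 0 1) := continuousOn_const.add (continuousOn_const.sub hP)
  have hqc : ∀ f : ℝ → ℝ, ContinuousOn f (Icc 0 1) →
      (∀ s ∈ Icc (0 : ℝ) 1, β ≤ f s ∧ f s ≤ K) →
      ContinuousOn (fun s => Real.log (q (f s))) (Icc 0 1) := by
    intro f hf hb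
    refine ContinuousOn.log (continuousOn_const.sub (hf.log fun s hs => ?_)) fun s hs => ?_
    · exact (hβ.trans_le (hb s hs).1).ne'
    · exact (one_pos.trans_le (hq1 _ (hβ.trans_le (hb s hs).1) (hb s hs).2)).ne'
  have hqd : ∀ (f : ℝ → ℝ) (d s : ℝ), HasDerivWithinAt f d (Ici s) s → β ≤ f s → f s ≤ K →
      HasDerivWithinAt (fun s => Real.log (q (f s))) (-(d / f s) / q (f s)) (Ici s) s := by
    intro f d s hf h1 h2
    exact ((hf.log (hβ.trans_le h1).ne').const_sub _).log
      (one_pos.trans_le (hq1 _ (hβ.trans_le h1) h2)).ne'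
  -- Both logarithms are oriented to increase with s. The term 2LM compensates for the radii with N
  -- ≥ 2, where the bounds are not assumed to fail.
  have key := lt_of_right_deriv_nonneg_of_pos (a := 0) (b := 1) (t := t)
    (g := fun s => -Real.log (q (u s)) + Real.log (q (v s)) + 2 * L * M s - 4 * L * s)
    (g' := fun s => -(-(p s / u s) / q (u s)) + -(-p s / v s) / q (v s) + 2 * L * N s - 4 * L)
    ((((hqc u huc hub).neg.add (hqc v hvc hvb)).add (continuousOn_const.mul hM)).sub
      (by fun_prop))
    (fun s hs => by
      have hs' := Ico_subset_Icc_self hs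
      refine (((hqd u _ s (hu' s hs) (hub s hs').1 (hub s hs').2).neg.add
        (hqd v _ s (hv' s hs) (hvb s hs').1 (hvb s hs').2)).add
        ((hM' s hs).const_mul (2 * L))).sub ?_
      simpa using ((hasDerivAt_id s).const_mul (4 * L)).hasDerivWithinAt)
  have hrate : ∀ s ∈ Ico (0 : ℝ) 1, 0 ≤ p s / (u s * q (u s)) ∧ 0 ≤ p s / (v s * q (v s)) ∧
      (N s ≤ 1 → 4 * L < p s / (u s * q (u s)) + p s / (v s * q (v s))) := by
    intro s hs
    have hs' := Ico_subset_Icc_self hs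
    have hu0 := hβ.trans_le (hub s hs').1
    have hv0 := hβ.trans_le (hvb s hs').1
    have hqu := one_pos.trans_le (hq1 _ hu0 (hub s hs').2)
    have hqv := one_pos.trans_le (hq1 _ hv0 (hvb s hs').2)
    have h1 : 0 ≤ p s / (u s * q (u s)) := div_nonneg (hp s) (by positivity)
    have h2 : 0 ≤ p s / (v s * q (v s)) := div_nonneg (hp s) (by positivity)
    refine ⟨h1, h2, fun hN => ?_⟩
    by_cases hc : p s ≤ 4 * u s * q (u s) * L
    · have := hbad s hs hN (by rw [hlog _ hu0]; exact hc)
      rw [hlog _ hv0] at this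
      have : 4 * L < p s / (v s * q (v s)) := by
        rw [lt_div_iff₀ (by positivity)]
        linarith
      linarith
    · have : 4 * L < p s / (u s * q (u s)) := by
        rw [lt_div_iff₀ (by positivity)]
        linarith
      linarith
  have hform : ∀ s, -(-(p s / u s) / q (u s)) + -(-p s / v s) / q (v s) =
      p s / (u s * q (u s)) + p s / (v s * q (v s)) := by
    intro s
    simp only [div_mul_eq_div_div, neg_div, neg_neg]
  have hlt := key
    (fun s hs => by
      obtain ⟨h1, h2, h3⟩ := hrate s hs
      simp only [hform]
      have hLN : 0 ≤ 2 * L * N s := by positivity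
      by_cases hN : N s ≤ 1
      · linarith [h3 hN]
      · have : (2 : ℝ) ≤ N s := by exact_mod_cast not_le.1 hN
        nlinarith) ht
    (by
      obtain ⟨h1, h2, h3⟩ := hrate t ht
      simp only [hform]
      have hLN : 0 ≤ 2 * L * N t := by positivity
      linarith [h3 hNt])
  have h0 : (0 : ℝ) ∈ Icc (0 : ℝ) 1 := by simp
  have h1 : (1 : ℝ) ∈ Icc (0 : ℝ) 1 := by simp
  -- The increase of g over [0,1] is at most L + L + 2L - 4L = 0.
  have a1 := hlq0 _ (hβ.trans_le (hub 1 h1).1) (hub 1 h1).2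
  have a2 := hlqL _ (hvb 1 h1).1 (hvb 1 h1).2
  have a3 := hlqL _ (hub 0 h0).1 (hub 0 h0).2
  have a4 := hlq0 _ (hβ.trans_le (hvb 0 h0).1) (hvb 0 h0).2
  have a5 : 2 * L * M 1 ≤ 2 * L := by nlinarith
  simp only [hM0] at hlt
  linarith

end RightDerivative

/-! ### Piecewise linear growth functions -/

section Growth

open Set

variable {E : Type*}

/-- The part of the intervals `[lo e, hi e]`, weighted by `c e`, that lies below `ρ`. -/
noncomputable def growth (s : Finset E) (c lo hi : E → ℝ) (ρ : ℝ) : ℝ :=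
  ∑ e ∈ s, c e * (min ρ (hi e) - min ρ (lo e))

theorem continuous_growth (s : Finset E) (c lo hi : E → ℝ) : Continuous (growth s c lo hi) := by
  unfold growth; fun_prop

-- The slope from the right is c e exactly while lo e ≤ ρ < hi e. This half-open condition is the
-- one for an edge to leave a closed ball, so the derivative is the cut cost at every ρ, breakpoints
-- included.
open Classical in
theorem hasDerivWithinAt_growth (s : Finset E) (c : E → ℝ) {lo hi : E → ℝ} (h : ∀ e, lo e ≤ hi e)
    (ρ : ℝ) : HasDerivWithinAt (growth s c lo hi)
      (∑ e ∈ s with lo e ≤ ρ ∧ ρ < hi e, c e) (Ici ρ) ρ := by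
  rw [Finset.sum_filter]
  refine HasDerivWithinAt.fun_sum fun e _ => ?_
  refine (((hasDerivWithinAt_min_const (hi e) ρ).sub
    (hasDerivWithinAt_min_const (lo e) ρ)).const_mul (c e)).congr_deriv ?_
  have := h e
  split_ifs <;> first | (simp; done) | grind

theorem growth_nonneg (s : Finset E) {c lo hi : E → ℝ} (hc : ∀ e, 0 ≤ c e)
    (h : ∀ e, lo e ≤ hi e) (ρ : ℝ) : 0 ≤ growth s c lo hi ρ :=
  Finset.sum_nonneg fun e _ => mul_nonneg (hc e) (sub_nonneg.2 (min_le_min_left ρ (h e)))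

theorem growth_one (s : Finset E) (c : E → ℝ) {lo hi : E → ℝ} (h1 : ∀ e, hi e ≤ 1)
    (h : ∀ e, lo e ≤ hi e) : growth s c lo hi 1 = ∑ e ∈ s, c e * (hi e - lo e) :=
  Finset.sum_congr rfl fun e _ => by
    rw [min_eq_right (h1 e), min_eq_right ((h e).trans (h1 e))]

theorem growth_zero (s : Finset E) (c : E → ℝ) {lo hi : E → ℝ} (h0 : ∀ e, 0 ≤ lo e)
    (h : ∀ e, lo e ≤ hi e) : growth s c lo hi 0 = 0 :=
  Finset.sum_eq_zero fun e _ => by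
    rw [min_eq_left (h0 e), min_eq_left ((h0 e).trans (h e)), sub_self, mul_zero]

theorem growth_le_growth_one (s : Finset E) {c lo hi : E → ℝ} (hc : ∀ e, 0 ≤ c e)
    (h1 : ∀ e, hi e ≤ 1) (h : ∀ e, lo e ≤ hi e) (ρ : ℝ) :
    growth s c lo hi ρ ≤ growth s c lo hi 1 := by
  rw [growth_one s c h1 h]
  refine Finset.sum_le_sum fun e _ => mul_le_mul_of_nonneg_left ?_ (hc e)
  have := h e
  rcases le_total ρ (hi e) with h2 | h2 <;> rcases le_total ρ (lo e) with h3 | h3 <;>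
    simp [h2, h3] <;> linarith

end Growth

namespace Multigraph

variable {V E : Type*} {G : Multigraph V E} {w : E → ℝ}

theorem edist_ne_top_of_truncDist_lt_one {z a : V} (h : G.truncDist w z a < 1) :
    G.edist w z a ≠ ⊤ := by
  intro ht
  simp [truncDist, ht] at h

theorem edist_ne_top_of_joins (hw : ∀ e, 0 ≤ w e) {z a b : V} {e : E} (he : G.Joins e a b)
    (h : G.edist w z a ≠ ⊤) : G.edist w z b ≠ ⊤ :=
  ((edist_triangle hw z a b).trans_lt (ENNReal.add_lt_top.2 ⟨h.lt_top,
    (edist_le_of_joins he).trans_lt ENNReal.ofReal_lt_top⟩)).ne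

theorem dist_le_add_of_joins (hw : ∀ e, 0 ≤ w e) {z a b : V} {e : E} (he : G.Joins e a b)
    (h : G.edist w z a ≠ ⊤) : G.dist w z b ≤ G.dist w z a + w e := by
  rw [dist, dist, ← ENNReal.toReal_ofReal (hw e), ← ENNReal.toReal_add h ENNReal.ofReal_ne_top]
  exact ENNReal.toReal_mono (ENNReal.add_ne_top.2 ⟨h, ENNReal.ofReal_ne_top⟩)
    ((edist_triangle hw z a b).trans (add_le_add le_rfl (edist_le_of_joins he)))

end Multigraph

/-! ### Costs, fractional weights and volumes -/

namespace MulticutInstance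

open Multigraph

variable {V E : Type*} [Fintype E] {r : ℕ} (I : MulticutInstance V E r)
  (F : Set E) (x : E → ℝ) (y : Fin r → E → ℝ)

/-- The fractional value `∑_{e ∈ D} c_e x_e` of an edge set. -/
noncomputable def weight (D : Set E) : ℝ := ∑ e, D.indicator (fun e => I.cost e * x e) e

theorem volX_eq (S : Set V) : I.volX x S = I.beta x + I.weight x (I.edgesIn S) := rfl

theorem costOf_empty : I.costOf (∅ : Set E) = 0 := by simp [costOf]

theorem costOf_union_le (Y Z : Set E) : I.costOf (Y ∪ Z) ≤ I.costOf Y + I.costOf Z := by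
  rw [costOf, costOf, costOf, ← Finset.sum_add_distrib]
  refine Finset.sum_le_sum fun e _ => ?_
  have := I.cost_nonneg e
  simp only [Set.indicator, Set.mem_union]
  split_ifs <;> simp_all

theorem costOf_mono {Y Z : Set E} (h : Y ⊆ Z) : I.costOf Y ≤ I.costOf Z :=
  Finset.sum_le_sum fun e _ => Set.indicator_le_indicator_of_subset h I.cost_nonneg e

theorem cost_le_sSup {D : Set E} {e : E} (he : e ∈ D) : I.cost e ≤ sSup (I.cost '' D) :=
  le_csSup (Set.toFinite _).bddAbove ⟨e, he, rfl⟩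

theorem IsAllButMax.costOf_le {D Y : Set E} (h : I.IsAllButMax D Y) :
    I.costOf Y ≤ I.costButMax D := by
  rcases h with ⟨rfl, rfl⟩ | ⟨e, he, hmax, rfl⟩
  · simp [costButMax, costOf_empty]
  · have hs : sSup (I.cost '' D) ≤ I.cost e :=
      csSup_le ⟨_, e, he, rfl⟩ (by rintro _ ⟨f, hf, rfl⟩; exact hmax f hf)
    have : I.costOf D = I.costOf (D \ {e}) + I.cost e := by
      classical
      have h2 : I.cost e = ∑ f, if f = e then I.cost f else 0 := by simp
      rw [costOf, costOf, h2, ← Finset.sum_add_distrib]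
      refine Finset.sum_congr rfl fun f _ => ?_
      by_cases hfe : f = e
      · subst hfe; simp [Set.indicator, he]
      · simp [Set.indicator, hfe]
    rw [costButMax]
    linarith

/-- If at most one edge of `D` is not in `F`, then the edges of `D` in `F` pay for all but the most
expensive edge of `D`. -/
theorem costButMax_le_of_subsingleton {D F : Set E} (h : (D \ F).Subsingleton) :
    I.costButMax D ≤ I.costOf (D ∩ F) := by
  have hsup : 0 ≤ sSup (I.cost '' D) :=
    Real.sSup_nonneg (by rintro _ ⟨f, -, rfl⟩; exact I.cost_nonneg f)
  have hu := I.costOf_union_le (D ∩ F) (D \ F)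
  rw [Set.inter_union_sdiff] at hu
  rw [costButMax]
  rcases h.eq_empty_or_singleton with h0 | ⟨e, he⟩
  · rw [h0, costOf_empty] at hu
    linarith
  · have h1 : I.costOf (D \ F) = I.cost e := by
      classical
      simp [he, costOf, Set.indicator]
    have h2 := I.cost_le_sSup (D := D) (e := e) (by
      have : e ∈ D \ F := by rw [he]; rfl
      exact this.1)
    linarith

variable {F x y}

section Weight

theorem weight_nonneg (hx : ∀ e, 0 ≤ x e) (D : Set E) : 0 ≤ I.weight x D :=
  Finset.sum_nonneg fun e _ =>
    Set.indicator_nonneg (fun e _ => mul_nonneg (I.cost_nonneg e) (hx e)) e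

theorem weight_mono (hx : ∀ e, 0 ≤ x e) {D D' : Set E} (h : D ⊆ D') :
    I.weight x D ≤ I.weight x D' :=
  Finset.sum_le_sum fun e _ => Set.indicator_le_indicator_of_subset h
    (fun e => mul_nonneg (I.cost_nonneg e) (hx e)) e

theorem weight_diff_add {D D' : Set E} (h : D' ⊆ D) :
    I.weight x (D \ D') + I.weight x D' = I.weight x D := by
  rw [weight, weight, weight, ← Finset.sum_add_distrib]
  refine Finset.sum_congr rfl fun e _ => ?_
  have := @h e
  by_cases h1 : e ∈ D' <;> by_cases h2 : e ∈ D <;> simp_all [Set.indicator]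

theorem weight_le_lpValue (hx : ∀ e, 0 ≤ x e) (D : Set E) : I.weight x D ≤ I.lpValue x := by
  refine (I.weight_mono hx (Set.subset_univ D)).trans (le_of_eq ?_)
  simp [weight, lpValue]

theorem lpValue_nonneg (hx : ∀ e, 0 ≤ x e) : 0 ≤ I.lpValue x :=
  (I.weight_nonneg hx ∅).trans (I.weight_le_lpValue hx ∅)

theorem beta_nonneg (hx : ∀ e, 0 ≤ x e) : 0 ≤ I.beta x :=
  div_nonneg (I.lpValue_nonneg hx) (Nat.cast_nonneg r)

theorem mul_beta (hr : r ≠ 0) : r * I.beta x = I.lpValue x :=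
  mul_div_cancel₀ _ (Nat.cast_ne_zero.2 hr)

theorem volX_le (hx : ∀ e, 0 ≤ x e) (hr : r ≠ 0) (S : Set V) :
    I.volX x S ≤ (r + 1) * I.beta x := by
  have h1 := I.weight_le_lpValue hx (I.edgesIn S)
  have h2 := I.mul_beta (x := x) hr
  rw [volX_eq]
  linarith

end Weight

omit [Fintype E] in
theorem diff_ballIn (S : Set V) (i : Fin r) (z : V) (ρ : ℝ) :
    S \ I.ballIn x y S i z ρ = I.ballOut x y S i z ρ := by
  ext v; simp only [ballIn, ballOut, Set.mem_sdiff, Set.mem_inter_iff]; tauto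

section Volume

variable {I} (h : I.IsRoundable F x y)
include h

theorem IsRoundable.length_nonneg (i : Fin r) (e : E) : 0 ≤ x e + y i e :=
  add_nonneg (h.x_nonneg e) (h.y_nonneg i e)

theorem IsRoundable.ell_ends_le (i : Fin r) {e : E} (he : e ∈ F) :
    I.ell x y i (I.fst e) (I.snd e) ≤ x e := by
  have := I.dist_ends_le (h.length_nonneg i) e
  rwa [h.y_eq_zero i e he, add_zero] at this

/-- An x-edge has length x e alone. The near end lies within distance 1, so truncation is void
there; the far end is then at finite distance, so `ell` is a genuine distance and not the default 0.
-/
theorem IsRoundable.boundary_bounds {i : Fin r} {z u v : V} {ρ : ℝ} {e : E} (he : e ∈ F)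
    (hj : I.Joins e u v) (hu : I.truncDist (fun e => x e + y i e) z u ≤ ρ) (hρ : ρ < 1) :
    I.ell x y i z u = I.truncDist (fun e => x e + y i e) z u ∧
      I.truncDist (fun e => x e + y i e) z v ≤ I.ell x y i z v ∧
      I.ell x y i z v ≤ I.truncDist (fun e => x e + y i e) z u + x e := by
  have hlt := hu.trans_lt hρ
  have hu' := edist_ne_top_of_truncDist_lt_one hlt
  have h1 := dist_le_add_of_joins (h.length_nonneg i) hj hu'
  rw [← truncDist_eq_dist hlt] at h1
  simp only [h.y_eq_zero i e he, add_zero] at h1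
  exact ⟨(truncDist_eq_dist hlt).symm,
    truncDist_le_dist (edist_ne_top_of_joins (h.length_nonneg i) hj hu'), h1⟩

/-- Every x-edge touching the ball contributes at most c_e x_e, boundary edges because ρ is below
the distance of the far end. The right side depends on the carved region only, which is the form
used for charging. -/
theorem IsRoundable.vol_le (S : Set V) (i : Fin r) (z : V) {ρ : ℝ} (h0 : 0 ≤ ρ) (h1 : ρ < 1) :
    I.vol F x y S i z ρ ≤
      I.beta x + I.weight x (I.edgesIn S \ I.edgesIn (S \ I.ballIn x y S i z ρ)) := by
  classical
  rw [vol, weight, add_assoc, add_assoc, ← Finset.sum_add_distrib, ← Finset.sum_add_distrib]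
  gcongr with e
  have hce := I.cost_nonneg e
  have hxe := mul_nonneg hce (h.x_nonneg e)
  by_cases heF : e ∈ F
  · have hell := mul_le_mul_of_nonneg_left (h.ell_ends_le i heF) hce
    have hjf := h.boundary_bounds (i := i) (z := z) (ρ := ρ) heF (I.joins_fst_snd e)
    have hjs := h.boundary_bounds (i := i) (z := z) (ρ := ρ) heF (I.joins_fst_snd e).symm
    simp only [Set.indicator, Set.mem_inter_iff, Set.mem_ofPred_eq, Set.mem_sdiff, edgesIn, ballIn,
      ballOut, mem_ball_iff h0 h1, heF, true_and]
    by_cases hf : I.fst e ∈ S <;> by_cases hs : I.snd e ∈ S <;>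
      by_cases hfb : I.truncDist (fun e => x e + y i e) z (I.fst e) ≤ ρ <;>
      by_cases hsb : I.truncDist (fun e => x e + y i e) z (I.snd e) ≤ ρ <;>
      simp only [hf, hs, hfb, hsb, and_true, and_false, if_true, if_false,
        not_true, not_false_iff, add_zero, zero_add, le_refl]
    · exact hell
    · obtain ⟨a, b, c⟩ := hjf hfb h1
      exact mul_le_mul_of_nonneg_left (by linarith) hce
    · obtain ⟨a, b, c⟩ := hjs hsb h1
      exact mul_le_mul_of_nonneg_left (by linarith) hce
  · simp only [Set.indicator, Set.mem_inter_iff, Set.mem_ofPred_eq, heF, false_and, if_false]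
    split_ifs <;> simp [hxe]

theorem IsRoundable.volOut_le (S : Set V) (i : Fin r) (z : V) {ρ : ℝ} (h0 : 0 ≤ ρ) (h1 : ρ < 1) :
    I.volOut F x y S i z ρ ≤
      I.beta x + I.weight x (I.edgesIn S \ I.edgesIn (S \ I.ballOut x y S i z ρ)) := by
  classical
  rw [volOut, weight, add_assoc, add_assoc, ← Finset.sum_add_distrib, ← Finset.sum_add_distrib]
  gcongr with e
  have hce := I.cost_nonneg e
  have hxe := mul_nonneg hce (h.x_nonneg e)
  by_cases heF : e ∈ F
  · have hell := mul_le_mul_of_nonneg_left (h.ell_ends_le i heF) hce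
    have hjf := h.boundary_bounds (i := i) (z := z) (ρ := ρ) heF (I.joins_fst_snd e)
    have hjs := h.boundary_bounds (i := i) (z := z) (ρ := ρ) heF (I.joins_fst_snd e).symm
    simp only [Set.indicator, Set.mem_inter_iff, Set.mem_ofPred_eq, Set.mem_sdiff, edgesIn, ballIn,
      ballOut, mem_ball_iff h0 h1, heF, true_and]
    by_cases hf : I.fst e ∈ S <;> by_cases hs : I.snd e ∈ S <;>
      by_cases hfb : I.truncDist (fun e => x e + y i e) z (I.fst e) ≤ ρ <;>
      by_cases hsb : I.truncDist (fun e => x e + y i e) z (I.snd e) ≤ ρ <;>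
      simp only [hf, hs, hfb, hsb, and_true, and_false, if_true, if_false,
        not_true, not_false_iff, add_zero, zero_add, le_refl]
    · obtain ⟨a, b, c⟩ := hjf hfb h1
      exact mul_le_mul_of_nonneg_left (by linarith) hce
    · obtain ⟨a, b, c⟩ := hjs hsb h1
      exact mul_le_mul_of_nonneg_left (by linarith) hce
    · exact hell
  · simp only [Set.indicator, Set.mem_inter_iff, Set.mem_ofPred_eq, heF, false_and, if_false]
    split_ifs <;> simp [hxe]

omit h in
/-- The smaller truncated distance of an end of `e` from `z`. -/
noncomputable def nearEnd (I : MulticutInstance V E r) (x : E → ℝ) (y : Fin r → E → ℝ) (i : Fin r)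
    (z : V) (e : E) : ℝ :=
  min (I.truncDist (fun e => x e + y i e) z (I.fst e))
    (I.truncDist (fun e => x e + y i e) z (I.snd e))

omit h in
/-- The larger truncated distance of an end of `e` from `z`. -/
noncomputable def farEnd (I : MulticutInstance V E r) (x : E → ℝ) (y : Fin r → E → ℝ) (i : Fin r)
    (z : V) (e : E) : ℝ :=
  max (I.truncDist (fun e => x e + y i e) z (I.fst e))
    (I.truncDist (fun e => x e + y i e) z (I.snd e))

theorem IsRoundable.farEnd_sub_nearEnd_le_ell (i : Fin r) (z : V) (e : E) :
    I.farEnd x y i z e - I.nearEnd x y i z e ≤ I.ell x y i (I.fst e) (I.snd e) := by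
  rw [farEnd, nearEnd, max_sub_min_eq_abs, abs_sub_comm]
  exact abs_truncDist_sub_le_dist (h.length_nonneg i) z e

theorem IsRoundable.farEnd_sub_nearEnd_le (i : Fin r) (z : V) (e : E) :
    I.farEnd x y i z e - I.nearEnd x y i z e ≤ x e + y i e :=
  (h.farEnd_sub_nearEnd_le_ell i z e).trans (I.dist_ends_le (h.length_nonneg i) e)

-- The growth function measures an x-edge by the difference of truncated distances of its ends,
-- which is at most the `ell`-distance between them. It is the differentiable substitute for the
-- volume.
open Classical in
theorem IsRoundable.le_vol (S : Set V) (i : Fin r) (z : V) {ρ : ℝ} (h0 : 0 ≤ ρ) (h1 : ρ < 1) :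
    I.beta x + growth {e | e ∈ F ∧ e ∈ I.edgesIn S} I.cost (I.nearEnd x y i z)
      (I.farEnd x y i z) ρ ≤ I.vol F x y S i z ρ := by
  rw [vol, growth, add_assoc, add_assoc, ← Finset.sum_add_distrib, ← Finset.sum_add_distrib,
    Finset.sum_filter]
  gcongr with e
  have hce := I.cost_nonneg e
  by_cases heF : e ∈ F
  · have hell := h.farEnd_sub_nearEnd_le_ell i z e
    have hjf := h.boundary_bounds (i := i) (z := z) (ρ := ρ) heF (I.joins_fst_snd e)
    have hjs := h.boundary_bounds (i := i) (z := z) (ρ := ρ) heF (I.joins_fst_snd e).symm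
    simp only [Set.indicator, Set.mem_inter_iff, Set.mem_ofPred_eq, Set.mem_sdiff, edgesIn, ballIn,
      ballOut, mem_ball_iff h0 h1, heF, true_and, nearEnd, farEnd] at hell ⊢
    by_cases hf : I.fst e ∈ S <;> by_cases hs : I.snd e ∈ S <;>
      by_cases hfb : I.truncDist (fun e => x e + y i e) z (I.fst e) ≤ ρ <;>
      by_cases hsb : I.truncDist (fun e => x e + y i e) z (I.snd e) ≤ ρ <;>
      simp only [hf, hs, hfb, hsb, and_true, and_false, if_true, if_false,
        not_true, not_false_iff, add_zero, zero_add, le_refl]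
    · refine mul_le_mul_of_nonneg_left ?_ hce
      rwa [min_eq_right (max_le hfb hsb), min_eq_right ((min_le_left _ _).trans hfb)]
    · obtain ⟨a, b, c⟩ := hjf hfb h1
      rw [a, min_eq_left (not_le.1 hsb |>.le.trans (le_max_right _ _)),
        min_eq_left (hfb.trans (not_le.1 hsb).le), min_eq_right hfb]
    · obtain ⟨a, b, c⟩ := hjs hsb h1
      rw [a, min_eq_left (not_le.1 hfb |>.le.trans (le_max_left _ _)),
        min_eq_right (hsb.trans (not_le.1 hfb).le), min_eq_right hsb]
    · rw [min_eq_left (not_le.1 hfb |>.le.trans (le_max_left _ _)),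
        min_eq_left (le_min (not_le.1 hfb).le (not_le.1 hsb).le)]
      simp
  · simp [Set.indicator, heF]

open Classical in
theorem IsRoundable.le_volOut (S : Set V) (i : Fin r) (z : V) {ρ : ℝ} (h0 : 0 ≤ ρ) (h1 : ρ < 1) :
    I.beta x + (growth {e | e ∈ F ∧ e ∈ I.edgesIn S} I.cost (I.nearEnd x y i z)
      (I.farEnd x y i z) 1 - growth {e | e ∈ F ∧ e ∈ I.edgesIn S} I.cost (I.nearEnd x y i z)
      (I.farEnd x y i z) ρ) ≤ I.volOut F x y S i z ρ := by
  rw [volOut, growth, growth, ← Finset.sum_sub_distrib, add_assoc, add_assoc,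
    ← Finset.sum_add_distrib, ← Finset.sum_add_distrib, Finset.sum_filter]
  gcongr with e
  have hce := I.cost_nonneg e
  have hf1 := I.truncDist_le_one (w := fun e => x e + y i e) z (I.fst e)
  have hs1 := I.truncDist_le_one (w := fun e => x e + y i e) z (I.snd e)
  by_cases heF : e ∈ F
  · have hell := h.farEnd_sub_nearEnd_le_ell i z e
    have hjf := h.boundary_bounds (i := i) (z := z) (ρ := ρ) heF (I.joins_fst_snd e)
    have hjs := h.boundary_bounds (i := i) (z := z) (ρ := ρ) heF (I.joins_fst_snd e).symm
    simp only [Set.indicator, Set.mem_inter_iff, Set.mem_ofPred_eq, Set.mem_sdiff, edgesIn, ballIn,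
      ballOut, mem_ball_iff h0 h1, heF, true_and, nearEnd, farEnd, ← mul_sub,
      min_eq_right (max_le hf1 hs1), min_eq_right ((min_le_left _ _).trans hf1)] at hell ⊢
    by_cases hf : I.fst e ∈ S <;> by_cases hs : I.snd e ∈ S <;>
      by_cases hfb : I.truncDist (fun e => x e + y i e) z (I.fst e) ≤ ρ <;>
      by_cases hsb : I.truncDist (fun e => x e + y i e) z (I.snd e) ≤ ρ <;>
      simp only [hf, hs, hfb, hsb, and_true, and_false, if_true, if_false,
        not_true, not_false_iff, add_zero, zero_add, le_refl]
    · rw [min_eq_right (max_le hfb hsb), min_eq_right ((min_le_left _ _).trans hfb)]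
      simp
    · obtain ⟨a, b, c⟩ := hjf hfb h1
      refine mul_le_mul_of_nonneg_left ?_ hce
      rw [min_eq_left (not_le.1 hsb |>.le.trans (le_max_right _ _)),
        min_eq_left (hfb.trans (not_le.1 hsb).le), min_eq_right hfb,
        max_eq_right (hfb.trans (not_le.1 hsb).le)]
      linarith
    · obtain ⟨a, b, c⟩ := hjs hsb h1
      refine mul_le_mul_of_nonneg_left ?_ hce
      rw [min_eq_left (not_le.1 hfb |>.le.trans (le_max_left _ _)),
        min_eq_right (hsb.trans (not_le.1 hfb).le), min_eq_right hsb,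
        max_eq_left (hsb.trans (not_le.1 hfb).le)]
      linarith
    · rw [min_eq_left (not_le.1 hfb |>.le.trans (le_max_left _ _)),
        min_eq_left (le_min (not_le.1 hfb).le (not_le.1 hsb).le)]
      refine mul_le_mul_of_nonneg_left ?_ hce
      linarith
  · simp [Set.indicator, heF]

omit h [Fintype E] in
theorem mem_cut_ballIn_iff {S : Set V} {i : Fin r} {z : V} {ρ : ℝ} (h0 : 0 ≤ ρ) (h1 : ρ < 1)
    {e : E} : e ∈ I.cut S (I.ballIn x y S i z ρ) ↔
      e ∈ I.edgesIn S ∧ I.nearEnd x y i z e ≤ ρ ∧ ρ < I.farEnd x y i z e := by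
  simp only [cut, ballIn, edgesIn, nearEnd, farEnd, Set.mem_ofPred_eq, Set.mem_sdiff,
    Set.mem_inter_iff, mem_ball_iff h0 h1, min_le_iff, ← not_le, max_le_iff]
  tauto

end Volume

end MulticutInstance

/-! ### Existence of good radii -/

/-- The derivative of v ln(eK/v) is ln(K/v) ≥ 0 for v ≤ K. This lets a bound for the growth function
pass to the true volume, and from there to the charged weight. -/
theorem mul_log_le_mul_log {a b K : ℝ} (ha : 0 < a) (hab : a ≤ b) (hbK : b ≤ K) :
    a * Real.log (Real.exp 1 * K / a) ≤ b * Real.log (Real.exp 1 * K / b) := by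
  have hb := ha.trans_le hab
  have hK := hb.trans_le hbK
  have hlog : ∀ v, 0 < v → Real.log (Real.exp 1 * K / v) = 1 + Real.log K - Real.log v := by
    intro v hv
    rw [Real.log_div (by positivity) hv.ne', Real.log_mul (Real.exp_ne_zero _) hK.ne',
      Real.log_exp]
  rw [hlog a ha, hlog b hb]
  have h1 : a * (Real.log b - Real.log a) ≤ b - a := by
    rw [← Real.log_div hb.ne' ha.ne']
    calc a * Real.log (b / a) ≤ a * (b / a - 1) :=
          mul_le_mul_of_nonneg_left (Real.log_le_sub_one_of_pos (by positivity)) ha.le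
      _ = b - a := by field_simp
  have h2 : 0 ≤ (b - a) * (Real.log K - Real.log b) :=
    mul_nonneg (sub_nonneg.2 hab) (sub_nonneg.2 (Real.log_le_log hb hbK))
  linarith

theorem log_log_nonneg (r : ℕ) : 0 ≤ Real.log (Real.log (Real.exp 1 * (r + 1))) := by
  refine Real.log_nonneg ?_
  rw [Real.log_mul (Real.exp_ne_zero _) (by positivity), Real.log_exp]
  have : 0 ≤ Real.log ((r : ℝ) + 1) := Real.log_nonneg (by simp)
  linarith

namespace MulticutInstance

open Multigraph

variable {V E : Type*} [Fintype E] {r : ℕ} {I : MulticutInstance V E r}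
  {F : Set E} {x : E → ℝ} {y : Fin r → E → ℝ}

omit [Fintype E] in
theorem nearEnd_le_farEnd (i : Fin r) (z : V) (e : E) :
    I.nearEnd x y i z e ≤ I.farEnd x y i z e := min_le_max

omit [Fintype E] in
theorem nearEnd_nonneg (i : Fin r) (z : V) (e : E) : 0 ≤ I.nearEnd x y i z e :=
  le_min (truncDist_nonneg _ _) (truncDist_nonneg _ _)

omit [Fintype E] in
theorem farEnd_le_one (i : Fin r) (z : V) (e : E) : I.farEnd x y i z e ≤ 1 :=
  max_le (truncDist_le_one _ _) (truncDist_le_one _ _)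

open Classical in
/-- If at most one cut edge is not in `F`, the cut edges in `F` pay for all but the most expensive
cut edge. -/
theorem costButMax_cut_ballIn_le (S : Set V) (i : Fin r) (z : V) {ρ : ℝ} (h0 : 0 ≤ ρ) (h1 : ρ < 1)
    (hN : Finset.card {e ∈ ({e | e ∉ F ∧ e ∈ I.edgesIn S} : Finset E) |
      I.nearEnd x y i z e ≤ ρ ∧ ρ < I.farEnd x y i z e} ≤ 1) :
    I.costButMax (I.cut S (I.ballIn x y S i z ρ)) ≤
      ∑ e ∈ ({e | e ∈ F ∧ e ∈ I.edgesIn S} : Finset E) with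
        I.nearEnd x y i z e ≤ ρ ∧ ρ < I.farEnd x y i z e, I.cost e := by
  refine (I.costButMax_le_of_subsingleton (F := F) fun e he f hf => ?_).trans (le_of_eq ?_)
  · rw [Set.mem_sdiff, mem_cut_ballIn_iff h0 h1] at he hf
    exact Finset.card_le_one.1 hN e (by simp; tauto) f (by simp; tauto)
  · rw [costOf, Finset.filter_filter, Finset.sum_filter]
    refine Finset.sum_congr rfl fun e _ => ?_
    simp only [Set.indicator, Set.mem_inter_iff, mem_cut_ballIn_iff h0 h1]
    congr 1
    simp only [eq_iff_iff]
    tauto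

/-- A good radius always exists. -/
theorem IsRoundable.exists_goodRadius (h : I.IsRoundable F x y) (S : Set V) (i : Fin r) :
    ∃ ρ, I.GoodRadius F x y S i ρ := by
  classical
  have hr : r ≠ 0 := (Nat.zero_le _ |>.trans_lt i.2).ne'
  set z := I.source i
  set X : Finset E := {e | e ∈ F ∧ e ∈ I.edgesIn S} with hX
  set Y : Finset E := {e | e ∉ F ∧ e ∈ I.edgesIn S} with hY
  set lo := I.nearEnd x y i z
  set hi := I.farEnd x y i z
  have hlh : ∀ e, lo e ≤ hi e := nearEnd_le_farEnd i z
  have hlo : ∀ e, 0 ≤ lo e := nearEnd_nonneg i z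
  have hhi : ∀ e, hi e ≤ 1 := farEnd_le_one i z
  -- With unit weights on the edges outside F, the slope is the number N of such edges in the cut.
  have hMder : ∀ s ∈ Set.Ico (0 : ℝ) 1, HasDerivWithinAt (growth Y (fun _ => 1) lo hi)
      ((Finset.card {e ∈ Y | lo e ≤ s ∧ s < hi e} : ℕ) : ℝ) (Set.Ici s) s := fun s _ => by
    simpa using hasDerivWithinAt_growth Y (fun _ => 1) hlh s
  have hM1 : growth Y (fun _ => 1) lo hi 1 ≤ 1 := by
    rw [growth_one _ _ hhi hlh]
    calc ∑ e ∈ Y, 1 * (hi e - lo e) ≤ ∑ e ∈ Y, y i e := by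
          refine Finset.sum_le_sum fun e he => ?_
          have h1 := h.farEnd_sub_nearEnd_le i z e
          rw [h.x_eq_zero e (by simp [hY] at he; exact he.1), zero_add] at h1
          rwa [one_mul]
      _ ≤ ∑ e, y i e := Finset.sum_le_sum_of_subset_of_nonneg (Finset.subset_univ _)
          fun e _ _ => h.y_nonneg i e
      _ ≤ 1 := h.budget i
  have hP1 : growth X I.cost lo hi 1 ≤ I.weight x (I.edgesIn S) := by
    rw [growth_one _ _ hhi hlh, hX, Finset.sum_filter, weight]
    refine Finset.sum_le_sum fun e _ => ?_
    have hxe := mul_nonneg (I.cost_nonneg e) (h.x_nonneg e)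
    simp only [Set.indicator]
    split_ifs with ha hb hb
    · refine mul_le_mul_of_nonneg_left ?_ (I.cost_nonneg e)
      have h1 := h.farEnd_sub_nearEnd_le i z e
      rwa [h.y_eq_zero i e ha.1, add_zero] at h1
    · exact absurd ha.2 hb
    · exact hxe
    · exact le_rfl
  have hvol : ∀ ρ, 0 ≤ ρ → ρ < 1 → I.vol F x y S i z ρ ≤ I.volX x S := fun ρ h0 h1 =>
    (h.vol_le S i z h0 h1).trans
      (add_le_add_right (I.weight_mono h.x_nonneg Set.sdiff_subset) _)
  have hvolOut : ∀ ρ, 0 ≤ ρ → ρ < 1 → I.volOut F x y S i z ρ ≤ I.volX x S := fun ρ h0 h1 =>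
    (h.volOut_le S i z h0 h1).trans
      (add_le_add_right (I.weight_mono h.x_nonneg Set.sdiff_subset) _)
  have hL := log_log_nonneg r
  rcases (I.beta_nonneg h.x_nonneg).eq_or_lt with hβ | hβ
  -- If OPT = 0, both volumes vanish. Any radius with N ≤ 1 works: a cut x-edge has x e > 0, hence
  -- cost 0.
  · obtain ⟨ρ, ⟨h0, h1⟩, hN⟩ := exists_count_le_one (continuous_growth Y _ lo hi).continuousOn
      hMder (growth_zero Y _ hlo hlh) hM1
    have hlp : I.lpValue x = 0 := by
      rw [← I.mul_beta hr, ← hβ, mul_zero]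
    have hX0 : I.volX x S ≤ 0 := by
      have := I.volX_le h.x_nonneg hr S
      rwa [← hβ, mul_zero] at this
    have hv := h.le_vol S i z h0 h1
    have hv' := h.le_volOut S i z h0 h1
    have hg := growth_nonneg X I.cost_nonneg hlh ρ
    have hg' := growth_le_growth_one X I.cost_nonneg hhi hlh ρ
    have e1 : I.vol F x y S i z ρ = 0 :=
      le_antisymm ((hvol ρ h0 h1).trans hX0) (le_trans (by rw [← hβ, zero_add]; exact hg) hv)
    have e2 : I.volOut F x y S i z ρ = 0 :=
      le_antisymm ((hvolOut ρ h0 h1).trans hX0)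
        (le_trans (by rw [← hβ, zero_add]; exact sub_nonneg.2 hg') hv')
    have hc := costButMax_cut_ballIn_le (F := F) S i z h0 h1 hN
    have hc0 : ∑ e ∈ X with lo e ≤ ρ ∧ ρ < hi e, I.cost e = 0 := by
      refine Finset.sum_eq_zero fun e he => ?_
      simp only [hX, Finset.mem_filter, Finset.mem_univ, true_and] at he
      have h3 := h.farEnd_sub_nearEnd_le i z e
      rw [h.y_eq_zero i e he.1.1, add_zero] at h3
      have h4 : 0 < x e := lt_of_lt_of_le (sub_pos.2 (he.2.1.trans_lt he.2.2)) h3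
      have h5 := (Finset.sum_eq_zero_iff_of_nonneg
        fun e _ => mul_nonneg (I.cost_nonneg e) (h.x_nonneg e)).1 hlp e (Finset.mem_univ e)
      exact (mul_eq_zero.1 h5).resolve_right h4.ne'
    have hc1 := hc.trans_eq hc0
    exact ⟨ρ, h0, h1, by rw [e1]; simpa using hc1, by rw [e2]; simpa using hc1⟩
  · obtain ⟨ρ, ⟨h0, h1⟩, hN, hin, hout⟩ := exists_radius (β := I.beta x) (K := I.volX x S)
      (R := r + 1)
      (continuous_growth X I.cost lo hi).continuousOn
      (fun s _ => hasDerivWithinAt_growth X I.cost hlh s)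
      (continuous_growth Y _ lo hi).continuousOn hMder
      (fun s => Finset.sum_nonneg fun e _ => I.cost_nonneg e)
      (fun s _ => ⟨growth_nonneg X I.cost_nonneg hlh s,
        growth_le_growth_one X I.cost_nonneg hhi hlh s⟩)
      (growth_zero Y _ hlo hlh) hM1 hβ (add_le_add_right hP1 _) (I.volX_le h.x_nonneg hr S)
    have hc := costButMax_cut_ballIn_le (F := F) S i z h0 h1 hN
    have hg := growth_nonneg X I.cost_nonneg hlh ρ
    have hg' := growth_le_growth_one X I.cost_nonneg hhi hlh ρ
    refine ⟨ρ, h0, h1, hc.trans (hin.trans ?_), hc.trans (hout.trans ?_)⟩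
    · refine mul_le_mul_of_nonneg_right ?_ hL
      rw [mul_assoc, mul_assoc]
      exact mul_le_mul_of_nonneg_left (mul_log_le_mul_log (by linarith) (h.le_vol S i z h0 h1)
        (hvol ρ h0 h1)) (by norm_num)
    · refine mul_le_mul_of_nonneg_right ?_ hL
      rw [mul_assoc, mul_assoc]
      exact mul_le_mul_of_nonneg_left (mul_log_le_mul_log (by linarith) (h.le_volOut S i z h0 h1)
        (hvolOut ρ h0 h1)) (by norm_num)

end MulticutInstance

theorem Multigraph.cut_diff {V E : Type*} (G : Multigraph V E) {S A : Set V} (h : A ⊆ S) :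
    G.cut S (S \ A) = G.cut S A := by
  ext e
  have h1 := @h (G.fst e)
  have h2 := @h (G.snd e)
  simp only [Multigraph.cut, Set.mem_ofPred_eq, Set.mem_sdiff]
  tauto

theorem Multigraph.edgesIn_mono {V E : Type*} (G : Multigraph V E) {S A : Set V} (h : A ⊆ S) :
    G.edgesIn A ⊆ G.edgesIn S := fun _ he => ⟨h he.1, h he.2⟩

namespace MulticutInstance

open Multigraph

variable {V E : Type*} {r : ℕ} {I : MulticutInstance V E r}
  {F : Set E} {x : E → ℝ} {y : Fin r → E → ℝ}

/-! ### Counting pairs and termination -/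

section Pairs

theorem ncard_pairsIn_le (T : Set (Fin r)) (S : Set V) : (I.pairsIn T S).ncard ≤ T.ncard :=
  Set.ncard_le_ncard (fun _ h => h.1) T.toFinite

theorem ncard_pairsIn_add_le (T : Set (Fin r)) {S A : Set V} (h : A ⊆ S) :
    (I.pairsIn T A).ncard + (I.pairsIn T (S \ A)).ncard ≤ (I.pairsIn T S).ncard := by
  rw [← Set.ncard_union_eq _ (Set.toFinite _) (Set.toFinite _)]
  · refine Set.ncard_le_ncard ?_ (Set.toFinite _)
    rintro i (hi | hi)
    exacts [⟨hi.1, h hi.2.1, h hi.2.2⟩, ⟨hi.1, hi.2.1.1, hi.2.2.1⟩]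
  · exact Set.disjoint_left.2 fun i hi hi' => hi'.2.1.2 hi.2.1

/-- A separated pair belongs to neither side. -/
theorem ncard_pairsIn_add_lt {T : Set (Fin r)} {S A : Set V} (h : A ⊆ S) {i : Fin r}
    (hi : i ∈ I.pairsIn T S) (hsep : ¬ (I.source i ∈ A ↔ I.sink i ∈ A)) :
    (I.pairsIn T A).ncard + (I.pairsIn T (S \ A)).ncard < (I.pairsIn T S).ncard := by
  rw [← Set.ncard_union_eq (Set.disjoint_left.2 fun i hi hi' => hi'.2.1.2 hi.2.1)
    (Set.toFinite _) (Set.toFinite _)]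
  refine Set.ncard_lt_ncard ⟨?_, fun hsub => ?_⟩ (Set.toFinite _)
  · rintro i (hi | hi)
    exacts [⟨hi.1, h hi.2.1, h hi.2.2⟩, ⟨hi.1, hi.2.1.1, hi.2.2.1⟩]
  · rcases hsub hi with hi' | hi'
    · exact hsep ⟨fun _ => hi'.2.2, fun _ => hi'.2.1⟩
    · exact hsep ⟨fun hA => absurd hA hi'.2.1.2, fun hA => absurd hA hi'.2.2.2⟩

theorem two_mul_ncard_pairsIn_region_le (T : Set (Fin r)) (S : Set V) (i : Fin r) (ρ : ℝ) :
    2 * (I.pairsIn T (I.region x y T S i ρ)).ncard ≤ T.ncard := by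
  unfold region
  split_ifs with hle
  · exact hle
  · have h1 := I.ncard_pairsIn_add_le T
      (show I.ballIn x y S i (I.source i) ρ ⊆ S from Set.inter_subset_right)
    rw [diff_ballIn] at h1
    have h2 := I.ncard_pairsIn_le T S
    omega

end Pairs

variable [Fintype E]

theorem Step.two_mul_ncard_le {T : Set (Fin r)} {S A : Set V} {Y : Set E}
    (hs : I.Step F x y T S A Y) : 2 * (I.pairsIn T A).ncard ≤ T.ncard := by
  obtain ⟨i, -, ρ, -, rfl, -⟩ := hs
  exact two_mul_ncard_pairsIn_region_le T S i ρ

theorem Step.subset {T : Set (Fin r)} {S A : Set V} {Y : Set E} (hs : I.Step F x y T S A Y) :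
    A ⊆ S := by
  obtain ⟨i, -, ρ, -, rfl, -⟩ := hs
  unfold region
  split_ifs
  exacts [Set.inter_subset_right, Set.sdiff_subset]

theorem Step.isAllButMax {T : Set (Fin r)} {S A : Set V} {Y : Set E}
    (hs : I.Step F x y T S A Y) : I.IsAllButMax (I.cut S A) Y := by
  obtain ⟨i, -, ρ, -, -, h⟩ := hs
  exact h

/-- The region separates the chosen pair. -/
theorem Step.exists_separated (h : I.IsRoundable F x y) {T : Set (Fin r)} {S A : Set V} {Y : Set E}
    (hs : I.Step F x y T S A Y) :
    ∃ i ∈ I.pairsIn T S, ¬ (I.source i ∈ A ↔ I.sink i ∈ A) := by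
  obtain ⟨i, hi, ρ, ⟨h0, h1, -⟩, rfl, -⟩ := hs
  obtain ⟨hsS, htS⟩ := hi.2.ends_mem two_ne_zero (I.source_ne_sink i)
  refine ⟨i, ⟨hi.1, hsS, htS⟩, ?_⟩
  have hs' : I.source i ∈ I.ball (fun e => x e + y i e) (I.source i) ρ := by
    rw [mem_ball_iff h0 h1, truncDist_self]
    exact h0
  have ht' : I.sink i ∉ I.ball (fun e => x e + y i e) (I.source i) ρ := by
    rw [mem_ball_iff h0 h1, truncDist_eq_one (h.walk i)]
    exact not_le.2 h1
  unfold region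
  split_ifs
  · simp [ballIn, hs', ht', hsS]
  · simp [ballOut, hs', ht', htS]

theorem Step.diff_ssubset (h : I.IsRoundable F x y) {T : Set (Fin r)} {S A : Set V} {Y : Set E}
    (hs : I.Step F x y T S A Y) : S \ A ⊂ S := by
  obtain ⟨i, hi, hsep⟩ := hs.exists_separated h
  refine ⟨Set.sdiff_subset, fun hsub => hsep ?_⟩
  exact ⟨fun hA => absurd hA (hsub hi.2.1).2, fun hA => absurd hA (hsub hi.2.2).2⟩

/-- A carved region presupposes an active pair, so T is nonempty and halving strictly decreases its
size. -/
theorem Loop.two_mul_ncard_le {T : Set (Fin r)} {S : Set V} {R : Set (Set V)} {Z : Set E}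
    (hl : I.Loop F x y T S R Z) : ∀ A ∈ R, 2 * (I.pairsIn T A).ncard ≤ T.ncard ∧ T.Nonempty := by
  induction hl with
  | done S h => simp
  | step S A Y R Z hs hl ih =>
    rintro A' (rfl | hA')
    · obtain ⟨i, hi, -⟩ := id hs
      exact ⟨hs.two_mul_ncard_le, i, hi.1⟩
    · exact ih A' hA'

section Halting

theorem IsRoundable.loopHalts [Finite V] (h : I.IsRoundable F x y) (T : Set (Fin r)) (S : Set V) :
    I.LoopHalts F x y T S := by
  induction S using WellFoundedLT.induction with
  | ind S ih =>
    exact .intro S (fun i _ => h.exists_goodRadius S i) fun A Y hs => ih _ (hs.diff_ssubset h)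

/-- Every execution of the rounding procedure terminates. -/
theorem IsRoundable.halts [Finite V] (h : I.IsRoundable F x y) (U : Set V) (T : Set (Fin r)) :
    I.Halts F x y U T := by
  induction hn : T.ncard using Nat.strong_induction_on generalizing U T with
  | _ n ih =>
    refine .intro U T (h.loopHalts T U) fun R Z hl A hA => ih _ ?_ _ _ rfl
    obtain ⟨h1, h2⟩ := hl.two_mul_ncard_le A hA
    have := (Set.ncard_pos T.toFinite).2 h2
    omega

end Halting

/-! ### Feasibility of the output -/

section Feasibility

omit [Fintype E] in
theorem IsAllButMax.diff_subsingleton {D Y : Set E} (h : I.IsAllButMax D Y) :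
    (D \ Y).Subsingleton := by
  rcases h with ⟨rfl, rfl⟩ | ⟨e, he, -, rfl⟩
  · simp
  · rw [Set.sdiff_sdiff_cancel_left (Set.singleton_subset_iff.2 he)]
    exact Set.subsingleton_singleton

/-- Two surviving disjoint paths would lie in A, which the recursive call excludes, or in S \ A,
which the rest of the loop excludes; at the end of the loop no pair is active. -/
theorem Loop.not_edgeConnected {T : Set (Fin r)} {S : Set V} {R : Set (Set V)} {Z : Set E}
    (hl : I.Loop F x y T S R Z) (sub : Set V → Set E)
    (hsub : ∀ A ∈ R, ∀ i ∈ I.pairsIn T A,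
      ¬ I.EdgeConnected (I.edgesIn A \ sub A) 2 (I.source i) (I.sink i)) :
    ∀ i ∈ T, ¬ I.EdgeConnected (I.edgesIn S \ (Z ∪ ⋃ A ∈ R, sub A)) 2 (I.source i) (I.sink i) := by
  induction hl with
  | done S h =>
    intro i hi hc
    exact (h ▸ (⟨hi, hc.mono Set.sdiff_subset⟩ : i ∈ I.active T S) : i ∈ (∅ : Set (Fin r)))
  | step S A Y R Z hs hl ih =>
    intro i hi hc
    have hcut : (I.edgesIn S \ (Y ∪ Z ∪ ⋃ A' ∈ insert A R, sub A') ∩ I.cut S A).Subsingleton :=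
      hs.isAllButMax.diff_subsingleton.anti fun e he =>
        ⟨he.2, fun hY => he.1.2 (Or.inl (Or.inl hY))⟩
    rcases hc.side_of_cut_subsingleton Set.sdiff_subset hcut (I.source_ne_sink i) with
      ⟨h1, h2, h3⟩ | h3
    · refine hsub A (Set.mem_insert _ _) i ⟨hi, h1, h2⟩ (h3.mono fun e he => ⟨he.2, fun hA => ?_⟩)
      exact he.1.2 (Or.inr (Set.mem_biUnion (Set.mem_insert A R) hA))
    · refine ih (fun A' hA' => hsub A' (Set.mem_insert_of_mem _ hA')) i hi
        (h3.mono fun e he => ⟨he.2, fun hZ => he.1.2 ?_⟩)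
      rcases hZ with hZ | hZ
      · exact Or.inl (Or.inr hZ)
      · exact Or.inr (Set.biUnion_subset_biUnion_left (Set.subset_insert A R) hZ)

theorem Output.not_edgeConnected {U : Set V} {T : Set (Fin r)} {Z : Set E}
    (ho : I.Output F x y U T Z) :
    ∀ i ∈ T, ¬ I.EdgeConnected (I.edgesIn U \ Z) 2 (I.source i) (I.sink i) := by
  induction ho with
  | mk U T R Z sub hl hr ih => exact hl.not_edgeConnected sub ih

theorem Output.isFeasible {Z : Set E} (ho : I.Output F x y Set.univ Set.univ Z) :
    I.IsFeasible 2 Z := fun i hc =>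
  ho.not_edgeConnected i (Set.mem_univ i)
    (hc.mono fun _ he => ⟨⟨Set.mem_univ _, Set.mem_univ _⟩, he⟩)

end Feasibility

/-! ### The cost of the output -/

section Cost

/-- Ball and complement get the same bound, since they have the same cut and `GoodRadius` controls
both volumes. -/
theorem Step.costOf_le (h : I.IsRoundable F x y) {T : Set (Fin r)} {S A : Set V} {Y : Set E}
    (hs : I.Step F x y T S A Y) :
    I.costOf Y ≤ 4 * Real.log (Real.log (Real.exp 1 * (r + 1))) *
      ((I.beta x + I.weight x (I.edgesIn S \ I.edgesIn (S \ A))) *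
        Real.log (Real.exp 1 * I.volX x S /
          (I.beta x + I.weight x (I.edgesIn S \ I.edgesIn (S \ A))))) := by
  classical
  have hL := log_log_nonneg r
  have hβ := I.beta_nonneg h.x_nonneg
  obtain ⟨W, h1, h2, h3⟩ : ∃ W, I.beta x ≤ W ∧
      W ≤ I.beta x + I.weight x (I.edgesIn S \ I.edgesIn (S \ A)) ∧
      I.costButMax (I.cut S A) ≤ 4 * W * Real.log (Real.exp 1 * I.volX x S / W) *
        Real.log (Real.log (Real.exp 1 * (r + 1))) := by
    obtain ⟨i, hi, ρ, ⟨h0, h1, hin, hout⟩, rfl, -⟩ := hs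
    have hg := growth_nonneg {e | e ∈ F ∧ e ∈ I.edgesIn S} I.cost_nonneg
      (I.nearEnd_le_farEnd (x := x) (y := y) i (I.source i)) ρ
    have hg' := growth_le_growth_one {e | e ∈ F ∧ e ∈ I.edgesIn S} I.cost_nonneg
      (I.farEnd_le_one (x := x) (y := y) i (I.source i)) (nearEnd_le_farEnd i (I.source i)) ρ
    unfold region
    split_ifs
    · exact ⟨_, by linarith [h.le_vol S i (I.source i) h0 h1], h.vol_le S i _ h0 h1, hin⟩
    · refine ⟨_, by linarith [h.le_volOut S i (I.source i) h0 h1], h.volOut_le S i _ h0 h1, ?_⟩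
      rwa [← diff_ballIn, I.cut_diff (A := I.ballIn x y S i _ ρ) Set.inter_subset_right]
  have hle : I.beta x + I.weight x (I.edgesIn S \ I.edgesIn (S \ A)) ≤ I.volX x S :=
    add_le_add_right (I.weight_mono h.x_nonneg Set.sdiff_subset) _
  refine (IsAllButMax.costOf_le I hs.isAllButMax).trans (h3.trans ?_)
  have key : W * Real.log (Real.exp 1 * I.volX x S / W) ≤
      (I.beta x + I.weight x (I.edgesIn S \ I.edgesIn (S \ A))) *
        Real.log (Real.exp 1 * I.volX x S /
          (I.beta x + I.weight x (I.edgesIn S \ I.edgesIn (S \ A)))) := by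
    rcases hβ.eq_or_lt with h0 | h0
    · obtain ⟨i, -⟩ := id hs
      have hX := I.volX_le h.x_nonneg (Nat.zero_le _ |>.trans_lt i.2).ne' S
      rw [← h0, mul_zero] at hX
      have e1 : W = 0 := le_antisymm (by linarith) (by linarith)
      have e2 : I.beta x + I.weight x (I.edgesIn S \ I.edgesIn (S \ A)) = 0 :=
        le_antisymm (by linarith) (by linarith)
      simp [e1, e2]
    · exact mul_log_le_mul_log (h0.trans_le h1) h2 hle
  nlinarith

/-- The charging inequality for one region of weight `w` whose inside has weight `w'`. -/
theorem charge_region {β w w' V V₀ R d m : ℝ} (hβ : 0 ≤ β) (hw' : 0 ≤ w') (hww : w' ≤ w)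
    (hwV : β + w ≤ V) (hV : V ≤ V₀) (hV₀ : V₀ ≤ R * β) (hd : 0 ≤ d) :
    (β + w) * Real.log (Real.exp 1 * V / (β + w)) +
        (w' * (d + Real.log ((β + w') / β)) + m * (β * Real.log (Real.exp 1 * R))) ≤
      w * (d + 1 + Real.log (V₀ / β)) + (m + 1) * (β * Real.log (Real.exp 1 * R)) := by
  rcases hβ.eq_or_lt with rfl | hβ
  · have : w = 0 := le_antisymm (by linarith) (by linarith)
    have : w' = 0 := le_antisymm (by linarith) hw'
    simp [*]
  · have hV0 : 0 < V := by linarith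
    have hR : 0 < R := pos_of_mul_pos_left (hV0.trans_le (hV.trans hV₀)) hβ.le
    rw [Real.log_div (by positivity) (by linarith), Real.log_mul (Real.exp_ne_zero _) hV0.ne',
      Real.log_exp, Real.log_mul (Real.exp_ne_zero _) hR.ne', Real.log_exp,
      Real.log_div (by linarith) hβ.ne', Real.log_div (by linarith) hβ.ne']
    have h1 : Real.log V ≤ Real.log V₀ := Real.log_le_log hV0 hV
    have h2 : Real.log (β + w') ≤ Real.log (β + w) := Real.log_le_log (by linarith) (by linarith)
    have h3 : Real.log β ≤ Real.log (β + w) := Real.log_le_log hβ (by linarith)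
    have h4 : Real.log V₀ ≤ Real.log R + Real.log β := by
      rw [← Real.log_mul hR.ne' hβ.ne']
      exact Real.log_le_log (by linarith) hV₀
    -- The inner ln(β + w') is at most ln(β + w) and cancels against the -ln(β + w) of the cut cost.
    have a1 : w' * (d + (Real.log (β + w') - Real.log β)) ≤
        w * (d + (Real.log (β + w) - Real.log β)) := by
      refine mul_le_mul hww (by linarith) ?_ (hw'.trans hww)
      have : Real.log β ≤ Real.log (β + w') := Real.log_le_log hβ (by linarith)
      linarith
    have a2 : β * (1 + Real.log V - Real.log (β + w)) ≤ β * (1 + Real.log R) :=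
      mul_le_mul_of_nonneg_left (by linarith) hβ.le
    have a3 : w * Real.log V ≤ w * Real.log V₀ :=
      mul_le_mul_of_nonneg_left h1 (hw'.trans hww)
    linarith

theorem log_exp_mul_nonneg (r : ℕ) : 0 ≤ Real.log (Real.exp 1 * (r + 1)) := by
  refine Real.log_nonneg ?_
  have : (1 : ℝ) ≤ Real.exp 1 := Real.one_le_exp zero_le_one
  nlinarith [Nat.cast_nonneg (α := ℝ) r]

theorem IsRoundable.log_div_beta_nonneg (h : I.IsRoundable F x y) {S : Set V} {V₀ : ℝ}
    (hS : I.volX x S ≤ V₀) : 0 ≤ Real.log (V₀ / I.beta x) := by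
  rcases (I.beta_nonneg h.x_nonneg).eq_or_lt with h0 | h0
  · simp [← h0]
  · refine Real.log_nonneg ((one_le_div h0).2 ?_)
    have := I.weight_nonneg h.x_nonneg (I.edgesIn S)
    rw [volX_eq] at hS
    linarith

/-- V₀ bounds the volume at the start of the loop and stays fixed while S shrinks, so the charges of
the regions add up under one logarithm. The separated pair lies in neither A nor S \ A; its
disappearance from the count pays the β-term of the step. -/
theorem Loop.costOf_le (h : I.IsRoundable F x y) {T : Set (Fin r)} {S : Set V}
    {R : Set (Set V)} {Z : Set E} (hl : I.Loop F x y T S R Z) (sub : Set V → Set E) {d V₀ : ℝ}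
    (hd : 0 ≤ d) (hS : I.volX x S ≤ V₀) (hV₀ : V₀ ≤ (r + 1) * I.beta x)
    (hsub : ∀ A ∈ R, I.costOf (sub A) ≤ 4 * Real.log (Real.log (Real.exp 1 * (r + 1))) *
      (I.weight x (I.edgesIn A) * (d + Real.log (I.volX x A / I.beta x)) +
        (I.pairsIn T A).ncard * (I.beta x * Real.log (Real.exp 1 * (r + 1))))) :
    I.costOf (Z ∪ ⋃ A ∈ R, sub A) ≤ 4 * Real.log (Real.log (Real.exp 1 * (r + 1))) *
      (I.weight x (I.edgesIn S) * (d + 1 + Real.log (V₀ / I.beta x)) +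
        (I.pairsIn T S).ncard * (I.beta x * Real.log (Real.exp 1 * (r + 1)))) := by
  have hL := log_log_nonneg r
  have hβ := I.beta_nonneg h.x_nonneg
  have hΛ := mul_nonneg hβ (log_exp_mul_nonneg r)
  induction hl with
  | done S hact =>
    have hlog := h.log_div_beta_nonneg hS
    have hw := I.weight_nonneg h.x_nonneg (I.edgesIn S)
    simp only [Set.mem_empty_iff_false, Set.iUnion_of_empty, Set.iUnion_empty, Set.union_empty,
      costOf_empty]
    positivity
  | step S A Y R Z hs hl ih =>
    have hsubS : I.edgesIn (S \ A) ⊆ I.edgesIn S := I.edgesIn_mono Set.sdiff_subset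
    have ih' := ih
      (le_trans (add_le_add_right (I.weight_mono h.x_nonneg hsubS) _) hS)
      (fun A' hA' => hsub A' (Set.mem_insert_of_mem _ hA'))
    have hA := hsub A (Set.mem_insert _ _)
    have hY := hs.costOf_le h
    obtain ⟨i, hi, hsep⟩ := hs.exists_separated h
    have hcard := ncard_pairsIn_add_lt hs.subset hi hsep
    have hsplit := I.weight_diff_add (x := x) hsubS
    have hwA : I.weight x (I.edgesIn A) ≤ I.weight x (I.edgesIn S \ I.edgesIn (S \ A)) :=
      I.weight_mono h.x_nonneg fun e he =>
        ⟨I.edgesIn_mono hs.subset he, fun he' => he'.1.2 he.1⟩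
    have hch := charge_region (m := (I.pairsIn T A).ncard) hβ
      (I.weight_nonneg h.x_nonneg (I.edgesIn A)) hwA
      (add_le_add_right (I.weight_mono h.x_nonneg Set.sdiff_subset) _) hS hV₀ hd
    have hcost : I.costOf (Y ∪ Z ∪ ⋃ A' ∈ insert A R, sub A') ≤
        I.costOf Y + (I.costOf (sub A) + I.costOf (Z ∪ ⋃ A' ∈ R, sub A')) := by
      refine (I.costOf_mono (Z := Y ∪ (sub A ∪ (Z ∪ ⋃ A' ∈ R, sub A'))) ?_).trans
        ((I.costOf_union_le _ _).trans (add_le_add le_rfl (I.costOf_union_le _ _)))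
      rw [Set.biUnion_insert]
      intro e he
      simp only [Set.mem_union] at he ⊢
      tauto
    have hcard' : ((I.pairsIn T A).ncard : ℝ) + 1 + (I.pairsIn T (S \ A)).ncard ≤
        (I.pairsIn T S).ncard := by
      exact_mod_cast (by omega : (I.pairsIn T A).ncard + 1 + (I.pairsIn T (S \ A)).ncard ≤
        (I.pairsIn T S).ncard)
    refine hcost.trans ((add_le_add hY (add_le_add hA ih')).trans ?_)
    rw [← mul_add, ← mul_add]
    refine mul_le_mul_of_nonneg_left ?_ (by positivity)
    have hm := mul_le_mul_of_nonneg_right hcard' hΛ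
    have hw := congrArg (· * (d + 1 + Real.log (V₀ / I.beta x))) hsplit
    simp only [volX_eq] at hch hw ⊢
    linarith

theorem Output.eq_empty {U : Set V} {T : Set (Fin r)} {Z : Set E} (ho : I.Output F x y U T Z)
    (hT : T = ∅) : Z = ∅ := by
  obtain ⟨_, _, R, Z, sub, hl, -⟩ := ho
  cases hl with
  | done S h => simp
  | step S A Y R Z hs hl =>
    obtain ⟨i, hi, -⟩ := hs
    exact absurd hi.1 (by simp [hT])

/-- The cost of the output for a set of fewer than `2 ^ d` pairs. -/
theorem Output.costOf_le (h : I.IsRoundable F x y) (hr : r ≠ 0) {U : Set V} {T : Set (Fin r)}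
    {Z : Set E} (ho : I.Output F x y U T Z) {d : ℕ} (hd : T.ncard < 2 ^ d) :
    I.costOf Z ≤ 4 * Real.log (Real.log (Real.exp 1 * (r + 1))) *
      (I.weight x (I.edgesIn U) * (d + Real.log (I.volX x U / I.beta x)) +
        T.ncard * (I.beta x * Real.log (Real.exp 1 * (r + 1)))) := by
  have hL := log_log_nonneg r
  have hΛ := mul_nonneg (I.beta_nonneg h.x_nonneg) (log_exp_mul_nonneg r)
  induction ho generalizing d with
  | mk U T R Z sub hl hrec ih =>
    cases d with
    | zero =>
      have hT : T = ∅ := (Set.ncard_eq_zero T.toFinite).1 (by simpa using hd)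
      rw [(Output.mk U T R Z sub hl hrec).eq_empty hT, costOf_empty]
      have hlog := h.log_div_beta_nonneg (le_refl (I.volX x U))
      have hw := I.weight_nonneg h.x_nonneg (I.edgesIn U)
      positivity
    | succ d =>
      refine (hl.costOf_le h sub (d := d) (Nat.cast_nonneg d) le_rfl
        (I.volX_le h.x_nonneg hr U) fun A hA => ih A hA ?_).trans ?_
      · have := (hl.two_mul_ncard_le A hA).1
        rw [pow_succ] at hd
        omega
      · have hcard : ((I.pairsIn T U).ncard : ℝ) ≤ T.ncard := by
          exact_mod_cast ncard_pairsIn_le T U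
        push_cast
        gcongr

theorem Output.costOf_le_log (h : I.IsRoundable F x y) {Z : Set E}
    (ho : I.Output F x y Set.univ Set.univ Z) :
    I.costOf Z ≤ 32 * (Real.log (r + 1) * Real.log (Real.log (Real.exp 1 * (r + 1)))) *
      I.lpValue x := by
  rcases eq_or_ne r 0 with rfl | hr
  · rw [ho.eq_empty (Set.eq_empty_of_isEmpty _), costOf_empty]
    simp
  have hr1 : (1 : ℝ) ≤ r := by exact_mod_cast Nat.one_le_iff_ne_zero.2 hr
  have hcard : (Set.univ : Set (Fin r)).ncard = r := by simp [Set.ncard_univ]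
  have hc := ho.costOf_le h hr (d := Nat.log 2 r + 1)
    (by rw [hcard]; exact Nat.lt_pow_succ_log_self one_lt_two r)
  have hlp := I.lpValue_nonneg h.x_nonneg
  have hL := log_log_nonneg r
  have hw : I.weight x (I.edgesIn Set.univ) = I.lpValue x := by
    simp [weight, lpValue, edgesIn]
  have hmul := I.mul_beta (x := x) hr
  set t := Real.log ((r : ℝ) + 1) with ht
  have hln2 := Real.log_two_gt_d9
  have ht1 : Real.log 2 ≤ t := Real.log_le_log two_pos (by linarith)
  -- The ratio is r + 1, because OPT = rβ; for β = 0 division by zero gives ln 0 = 0.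
  have hlog : Real.log (I.volX x Set.univ / I.beta x) ≤ t := by
    rcases (I.beta_nonneg h.x_nonneg).eq_or_lt with h0 | h0
    · rw [← h0, div_zero, Real.log_zero]
      linarith
    · have e : I.volX x Set.univ / I.beta x = r + 1 := by
        rw [volX_eq, hw, ← hmul]
        field_simp
        ring
      rw [e]
  -- The depth is at most 2 ln(r+1) because ln 2 > 1/2.
  have hdepth : (Nat.log 2 r : ℝ) ≤ 2 * t := by
    have h1 : ((2 : ℝ) ^ Nat.log 2 r) ≤ r := by exact_mod_cast Nat.pow_log_le_self 2 hr
    have h2 := Real.log_le_log (by positivity) (h1.trans (by linarith : (r : ℝ) ≤ r + 1))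
    rw [Real.log_pow, ← ht] at h2
    nlinarith [Nat.cast_nonneg (α := ℝ) (Nat.log 2 r)]
  rw [hcard, hw, ← mul_assoc (r : ℝ), hmul, Real.log_mul (Real.exp_ne_zero _) (by positivity),
    Real.log_exp, ← ht, ← mul_add] at hc
  refine hc.trans ?_
  rw [Real.log_mul (Real.exp_ne_zero _) (by positivity), Real.log_exp, ← ht] at hL ⊢
  push_cast
  -- The bracket is at most 2t + 1 + t + 1 + t = 4t + 2, and 2 ≤ 4t since t ≥ ln 2.
  calc 4 * Real.log (1 + t) * (I.lpValue x * ((Nat.log 2 r : ℝ) + 1 +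
        Real.log (I.volX x Set.univ / I.beta x) + (1 + t)))
      ≤ 4 * Real.log (1 + t) * (I.lpValue x * (8 * t)) := by
        gcongr
        linarith
    _ = 32 * (t * Real.log (1 + t)) * I.lpValue x := by ring

end Cost

end MulticutInstance

/-- For `r ≥ 3` the shifts inside the logarithms only cost a constant factor. -/
theorem log_mul_log_log_shift_le {r : ℝ} (hr : 3 ≤ r) :
    Real.log (r + 1) * Real.log (Real.log (Real.exp 1 * (r + 1))) ≤
      48 * (Real.log r * Real.log (Real.log r)) := by
  -- Equivalent to e^21 ≤ 3^20. A margin above 1 is needed, as ln ln r must stay away from 0.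
  have h3 : (1.05 : ℝ) ≤ Real.log 3 := by
    rw [Real.le_log_iff_exp_le (by norm_num)]
    refine le_of_pow_le_pow_left₀ (n := 20) (by norm_num) (by norm_num) ?_
    rw [← Real.exp_nat_mul]
    calc Real.exp ((20 : ℕ) * 1.05) = Real.exp 1 ^ 21 := by
          rw [← Real.exp_nat_mul]; norm_num
      _ ≤ (2.7182818286 : ℝ) ^ 21 := by
          gcongr
          exact Real.exp_one_lt_d9.le
      _ ≤ 3 ^ 20 := by norm_num
  set t := Real.log r with ht
  have ht1 : (1.05 : ℝ) ≤ t := h3.trans (Real.log_le_log (by norm_num) hr)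
  have h1 : Real.log (r + 1) ≤ 2 * t := by
    have := Real.log_le_log (by linarith) (by nlinarith : r + 1 ≤ r ^ 2)
    rwa [Real.log_pow, Nat.cast_two] at this
  have h0 : 0 ≤ Real.log (r + 1) := Real.log_nonneg (by linarith)
  have h2 : Real.log (Real.log (Real.exp 1 * (r + 1))) ≤ 24 * Real.log t := by
    rw [Real.log_mul (Real.exp_ne_zero _) (by linarith), Real.log_exp]
    -- Here 1 + ln(r+1) ≤ 1 + 2t ≤ 3t, and 1.05^23 > 3 explains the exponent 24.
    have h4 : 1 + Real.log (r + 1) ≤ t ^ 24 := by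
      have h5 : (3 : ℝ) ≤ t ^ 23 :=
        le_trans (by norm_num) (pow_le_pow_left₀ (by norm_num) ht1 23)
      have h6 : t ^ 24 = t * t ^ 23 := by ring
      nlinarith
    have h7 := Real.log_le_log (by linarith) h4
    rwa [Real.log_pow, Nat.cast_ofNat] at h7
  have h8 : 0 ≤ Real.log t := Real.log_nonneg (by linarith)
  calc _ ≤ (2 * t) * (24 * Real.log t) := mul_le_mul h1 h2
        (Real.log_nonneg (by
          rw [Real.log_mul (Real.exp_ne_zero _) (by linarith), Real.log_exp]; linarith))
        (by linarith)
    _ = 48 * (t * Real.log t) := by ring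

theorem theorem3p5 :
    ∃ C : ℝ, 0 < C ∧
      ∀ {V : Type*} {E : Type*} [Fintype V] [Fintype E] {r : ℕ} (I : MulticutInstance V E r)
        (x : E → ℝ) (y : Fin r → E → ℝ), I.IsLPOptimal 2 x y →
        I.TwoMCAlgHalts x y ∧
        ∀ Z : Set (E × Fin (r + 1)), I.TwoMCAlgOutput x y Z →
          I.subdivide.IsFeasible 2 Z ∧
          I.IsFeasible 2 (MulticutInstance.unsubdivide Z) ∧
          I.costOf (MulticutInstance.unsubdivide Z) ≤ I.subdivide.costOf Z ∧
          I.subdivide.costOf Z ≤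
            C * (Real.log (r + 1) * Real.log (Real.log (Real.exp 1 * (r + 1)))) * I.lpValue x ∧
          (3 ≤ r →
            I.subdivide.costOf Z ≤ C * (Real.log r * Real.log (Real.log r)) * I.lpValue x) := by
  -- 1536 = 32 · 48: the cost bound times the price of removing the shifts.
  refine ⟨1536, by norm_num, ?_⟩
  intro V E _ _ r I x y hopt
  have h := MulticutInstance.IsLPFeasible.isRoundable I hopt.1
  refine ⟨h.halts _ _, fun Z hZ => ?_⟩
  have hfeas := hZ.isFeasible
  have hcost := hZ.costOf_le_log h
  rw [I.lpValue_subdivide] at hcost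
  have hlp := I.lpValue_nonneg hopt.1.x_nonneg
  have ht : 0 ≤ Real.log ((r : ℝ) + 1) := Real.log_nonneg (by simp)
  have hL := log_log_nonneg r
  refine ⟨hfeas, MulticutInstance.IsFeasible.unsubdivide I hfeas, I.costOf_unsubdivide_le Z,
    hcost.trans ?_, fun hr => hcost.trans ?_⟩
  · gcongr
    norm_num
  · refine mul_le_mul_of_nonneg_right ?_ hlp
    linarith [log_mul_log_log_shift_le (r := r) (by exact_mod_cast hr)]
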